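/- Let $F=\mathbb{Q}((t))$. Let $F^{\mathrm{ab}}$ be the maximal abelian extension of $F$ and let $\widehat{F^{\mathrm{ab}}}=\mathbb{Q}^{\mathrm{ab}}((t^{1/2}))$, regarded as an extension of $F$ in the obvious way. A smooth plane curve of degree $d$ over $F$ is a nonsingular, geometrically irreducible curve in $\mathbb{P}^2_F$ given by a ternary form of degree $d$ over $F$. Say that such a curve $C$ has no abelian points if $C(F^{\mathrm{ab}})=\emptyset$ and $C(\widehat{F^{\mathrm{ab}}})=\emptyset$. 1. For every integer $d\ge 3$ there is a smooth plane curve of degree $d$ over $F$ without abelian points. 2. Let $d\ge 3$. There exist number fields of degree $d$ whose Galois closure over $\mathbb{Q}$ has Galois group $S_d$. For every such field $K$ and every $\mathbb{Q}$-basis $\alpha_1,\dots,\alpha_d$ of $K$, with norm form $N(X_1,\dots,X_d)=N_{K/\mathbb{Q}}\left(\sum_i X_i\alpha_i\right)$, the section of the hypersurface $$N(X_1,\dots,X_d)=tZ^d\qquad\text{in }\mathbb{P}^d_F$$ by a general $2$-plane over $F$ is a smooth plane curve of degree $d$ without abelian points. Here "general" means: there is a nonzero polynomial $P$ over $F$ in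 the entries of a $(d+1)\times 3$ matrix such that every $(d+1)\times 3$ matrix $A$ over $F$ with $P(A)\neq 0$ has rank $3$, and the plane parametrized by $A$ has the stated property. 3. In particular, there is a smooth plane quartic curve $C$ over $F$ of genus $3$ without abelian points. -/

import Mathlib

open MvPolynomial

noncomputable section

/-! ### The field `F = ℚ((t))` and its maximal abelian extension -/

/-- The maximal abelian extension of `K` inside the algebraic closure of `K`: the compositum of all
abelian Galois subextensions. -/
def maximalAbelianExtension (K : Type*) [Field K] : IntermediateField K (AlgebraicClosure K) :=
  ⨆ E : {E : IntermediateField K (AlgebraicClosure K) // IsAbelianGalois K E}, E.1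

/-- The field `F = ℚ((t))`. -/
abbrev LaurentQ : Type := LaurentSeries ℚ

/-- The element `t` of `F = ℚ((t))`. -/
def LaurentQ.t : LaurentQ := HahnSeries.single 1 1

/-- The field `ℚᵃᵇ`. -/
abbrev RatAb : Type := maximalAbelianExtension ℚ

/-- The map `F = ℚ((t)) → ℚᵃᵇ((s))`, `∑ aₙ tⁿ ↦ ∑ aₙ s²ⁿ`. It exhibits the target
as the complete field `ℚᵃᵇ((t^{1/2}))`. -/
def LaurentQ.toCompletedAb : LaurentQ →+* LaurentSeries RatAb :=
  (HahnSeries.embDomainRingHom (AddMonoidHom.mulLeft (2 : ℤ))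
    (fun a b h => by simpa using h) (fun a b => by simp)).comp
  { toFun := fun x => x.map (algebraMap ℚ RatAb)
    map_one' := by
      ext n
      by_cases h : n = 0 <;> simp [HahnSeries.coeff_one, h]
    map_mul' := fun x y =>
      HahnSeries.map_mul (algebraMap ℚ RatAb : ℚ →ₙ+* RatAb) (x := x) (y := y)
    map_zero' := by ext n; simp
    map_add' := fun x y => by ext n; simp }

theorem LaurentQ.toCompletedAb_t :
    LaurentQ.toCompletedAb LaurentQ.t = HahnSeries.single 1 1 ^ 2 := by
  have h : (LaurentQ.t.map (algebraMap ℚ RatAb) : LaurentSeries RatAb) = HahnSeries.single 1 1 := by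
    ext n
    by_cases h : n = 1 <;> simp [LaurentQ.t, h]
  change HahnSeries.embDomain _ (LaurentQ.t.map (algebraMap ℚ RatAb)) = _
  rw [h, HahnSeries.embDomain_single, HahnSeries.single_pow]
  simp

/-! ### Smooth plane curves -/

/-- A ternary form is nonsingular if it and its partial derivatives have no common zero in
`ℙ²` over the algebraic closure. -/
def IsNonsingularForm {k : Type*} [Field k] (f : MvPolynomial (Fin 3) k) : Prop :=
  ∀ v : Fin 3 → AlgebraicClosure k, v ≠ 0 →
    ¬ (aeval v f = 0 ∧ ∀ i, aeval v (pderiv i f) = 0)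

/-- A smooth, geometrically irreducible plane curve of degree `d` over `k`, given by its defining
form. -/
structure SmoothPlaneCurve (k : Type*) [Field k] (d : ℕ) where
  form : MvPolynomial (Fin 3) k
  isHomogeneous : form.IsHomogeneous d
  nonsingular : IsNonsingularForm form
  geomIrreducible : Irreducible (map (algebraMap k (AlgebraicClosure k)) form)

/-- The set `C(L)` of points of `C` over an extension `φ : k → L` of the base field, as a subset of
`ℙ²(L)`. -/
def SmoothPlaneCurve.points {k : Type*} [Field k] {d : ℕ} (C : SmoothPlaneCurve k d)
    {L : Type*} [Field L] (φ : k →+* L) : Set (Projectivization L (Fin 3 → L)) :=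
  {p | eval₂ φ p.rep C.form = 0}

/-! ### The genus, via the Čech complex of the structure sheaf

For the curve `C = {f = 0} ⊆ ℙ²` and `T ⊆ {0, 1, 2}` put `U_T = C ∩ {X i ≠ 0 for i ∈ T}`. The
sections of the structure sheaf over `U_T` are the degree zero part of the localization of the
homogeneous coordinate ring of `C` at `∏ i ∈ T, X i`. -/

namespace PlaneCech

variable {k : Type*} [Field k]

/-- The homogeneous coordinate ring `k[X₀, X₁, X₂] / (f)`. -/
abbrev CoordRing (f : MvPolynomial (Fin 3) k) : Type _ :=
  MvPolynomial (Fin 3) k ⧸ Ideal.span {f}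

/-- The image of `∏ i ∈ T, X i` in the homogeneous coordinate ring. -/
def mon (f : MvPolynomial (Fin 3) k) (T : Finset (Fin 3)) : CoordRing f :=
  Ideal.Quotient.mk _ (∏ i ∈ T, X i)

/-- The localization of the homogeneous coordinate ring at `∏ i ∈ T, X i`. -/
abbrev Loc (f : MvPolynomial (Fin 3) k) (T : Finset (Fin 3)) : Type _ :=
  Localization.Away (mon f T)

/-- The image of a polynomial in the localization. -/
def toLoc (f : MvPolynomial (Fin 3) k) (T : Finset (Fin 3)) :
    MvPolynomial (Fin 3) k →ₐ[k] Loc f T :=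
  (IsScalarTower.toAlgHom k (CoordRing f) (Loc f T)).comp (Ideal.Quotient.mkₐ k _)

/-- The sections of the structure sheaf over `U_T`: the fractions `a / (∏ i ∈ T, X i) ^ n` with `a`
homogeneous of degree `n * #T`. -/
def sections (f : MvPolynomial (Fin 3) k) (T : Finset (Fin 3)) : Submodule k (Loc f T) where
  carrier := {z | ∃ (n : ℕ) (a : MvPolynomial (Fin 3) k), a.IsHomogeneous (n * T.card) ∧
    z * toLoc f T (∏ i ∈ T, X i) ^ n = toLoc f T a}
  zero_mem' := ⟨0, 0, isHomogeneous_zero _ _ _, by simp⟩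
  add_mem' := by
    rintro z w ⟨n, a, ha, hz⟩ ⟨m, b, hb, hw⟩
    have hm : ∀ r : ℕ, ((∏ i ∈ T, X i : MvPolynomial (Fin 3) k) ^ r).IsHomogeneous
        (r * T.card) := fun r => by
      have h := (IsHomogeneous.prod T (fun i => (X i : MvPolynomial (Fin 3) k)) (fun _ => 1)
        (fun i _ => isHomogeneous_X k i)).pow r
      simpa [mul_comm] using h
    refine ⟨n + m, a * (∏ i ∈ T, X i) ^ m + b * (∏ i ∈ T, X i) ^ n, ?_, ?_⟩
    · refine IsHomogeneous.add ?_ ?_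
      · simpa [add_mul] using ha.mul (hm m)
      · simpa [add_mul, add_comm] using hb.mul (hm n)
    · simp only [map_add, map_mul, map_pow, ← hz, ← hw]
      ring
  smul_mem' := by
    rintro c z ⟨n, a, ha, hz⟩
    refine ⟨n, C c * a, by simpa using (isHomogeneous_C (Fin 3) c).mul ha, ?_⟩
    rw [← smul_eq_C_mul, map_smul, ← hz, smul_mul_assoc]

/-- The restriction map from `U_T` to the smaller open subset `U_T'`, `T ⊆ T'`. -/
def restrict (f : MvPolynomial (Fin 3) k) {T T' : Finset (Fin 3)} (h : T ⊆ T') :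
    Loc f T →ₐ[k] Loc f T' :=
  { IsLocalization.Away.lift (S := Loc f T) (mon f T) (g := algebraMap (CoordRing f) (Loc f T'))
      (isUnit_of_dvd_unit
        (map_dvd _ (map_dvd (Ideal.Quotient.mk _) (Finset.prod_dvd_prod_of_subset _ _ _ h)))
        (IsLocalization.Away.algebraMap_isUnit (S := Loc f T') (mon f T'))) with
    commutes' := fun c => by
      have h1 : algebraMap k (Loc f T) c =
          algebraMap (CoordRing f) (Loc f T) (algebraMap k (CoordRing f) c) :=
        IsScalarTower.algebraMap_apply k (CoordRing f) (Loc f T) c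
      have h2 : algebraMap k (Loc f T') c =
          algebraMap (CoordRing f) (Loc f T') (algebraMap k (CoordRing f) c) :=
        IsScalarTower.algebraMap_apply k (CoordRing f) (Loc f T') c
      rw [h1, h2]
      exact IsLocalization.Away.lift_eq _ _ _ }

/-- The first Čech differential
`(a₀, a₁, a₂) ↦ (a₁ - a₀ on U₀₁, a₂ - a₀ on U₀₂, a₂ - a₁ on U₁₂)`. -/
def d₀ (f : MvPolynomial (Fin 3) k) :
    (Loc f {0} × Loc f {1} × Loc f {2}) →ₗ[k] (Loc f {0, 1} × Loc f {0, 2} × Loc f {1, 2}) where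
  toFun a :=
    (restrict f (by decide) a.2.1 - restrict f (by decide) a.1,
      restrict f (by decide) a.2.2 - restrict f (by decide) a.1,
      restrict f (by decide) a.2.2 - restrict f (by decide) a.2.1)
  map_add' a b := by
    ext <;> simp only [Prod.fst_add, Prod.snd_add, map_add] <;> ring
  map_smul' c a := by
    ext <;> simp [smul_sub]

/-- The second Čech differential `(s₀₁, s₀₂, s₁₂) ↦ s₁₂ - s₀₂ + s₀₁ on U₀₁₂`. -/
def d₁ (f : MvPolynomial (Fin 3) k) :
    (Loc f {0, 1} × Loc f {0, 2} × Loc f {1, 2}) →ₗ[k] Loc f {0, 1, 2} where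
  toFun s :=
    restrict f (by decide) s.2.2 - restrict f (by decide) s.2.1 + restrict f (by decide) s.1
  map_add' a b := by
    simp only [Prod.fst_add, Prod.snd_add, map_add]; ring
  map_smul' c a := by
    simp [smul_sub, smul_add]

/-- The Čech `1`-cocycles with values in the structure sheaf of `{f = 0}`. -/
def Z1 (f : MvPolynomial (Fin 3) k) :
    Submodule k (Loc f {0, 1} × Loc f {0, 2} × Loc f {1, 2}) :=
  (sections f {0, 1}).prod ((sections f {0, 2}).prod (sections f {1, 2})) ⊓ LinearMap.ker (d₁ f)

/-- The Čech `1`-coboundaries with values in the structure sheaf of `{f = 0}`. -/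
def B1 (f : MvPolynomial (Fin 3) k) :
    Submodule k (Loc f {0, 1} × Loc f {0, 2} × Loc f {1, 2}) :=
  ((sections f {0}).prod ((sections f {1}).prod (sections f {2}))).map (d₀ f)

/-- The cohomology group `H¹(C, 𝒪_C)` of the curve `C = {f = 0}`. -/
abbrev H1 (f : MvPolynomial (Fin 3) k) : Type _ := Z1 f ⧸ (B1 f).submoduleOf (Z1 f)

end PlaneCech

/-- The genus `dim_k H¹(C, 𝒪_C)` of a smooth plane curve. -/
def SmoothPlaneCurve.genus {k : Type*} [Field k] {d : ℕ} (C : SmoothPlaneCurve k d) : ℕ :=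
  Module.finrank k (PlaneCech.H1 C.form)

/-! ### Curves over `ℚ((t))` without abelian points -/

/-- `C` has no point over the maximal abelian extension of `F = ℚ((t))`, and no point over the
complete field `ℚᵃᵇ((t^{1/2}))` either. -/
def SmoothPlaneCurve.NoAbelianPoints {d : ℕ} (C : SmoothPlaneCurve LaurentQ d) : Prop :=
  C.points (algebraMap LaurentQ (maximalAbelianExtension LaurentQ)) = ∅ ∧
    C.points LaurentQ.toCompletedAb = ∅

/-! ### The norm form hypersurface and its plane sections -/

/-- `K` is a number field of degree `d` the Galois group of whose Galois closure over `ℚ` is the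
symmetric group `S_d`. -/
def IsSymmetricNumberField (d : ℕ) (K : Type*) [Field K] [NumberField K] : Prop :=
  Module.finrank ℚ K = d ∧
    Nonempty (Gal(IntermediateField.normalClosure ℚ K (AlgebraicClosure K)/ℚ) ≃* Equiv.Perm (Fin d))

/-- The norm form `N(∑ Xᵢ bᵢ)` of `K/ℚ` in the basis `b`: the determinant of multiplication by the
generic element `∑ Xᵢ bᵢ`. -/
def normForm {d : ℕ} {K : Type*} [Field K] [NumberField K] (b : Module.Basis (Fin d) ℚ K) :
    MvPolynomial (Fin d) ℚ :=
  Matrix.det (∑ i, (X i : MvPolynomial (Fin d) ℚ) • (Algebra.leftMulMatrix b (b i)).map C)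

theorem eval_normForm {d : ℕ} {K : Type*} [Field K] [NumberField K]
    (b : Module.Basis (Fin d) ℚ K) (x : Fin d → ℚ) :
    eval x (normForm b) = Algebra.norm ℚ (∑ i, x i • b i) := by
  rw [Algebra.norm_eq_matrix_det b, normForm, RingHom.map_det]
  congr 1
  ext p q
  simp [Matrix.sum_apply, map_sum]

/-- The form `N(X₁, …, X_d) - t Z ^ d` over `F = ℚ((t))`, with `Xᵢ = X (some i)` and
`Z = X none`. -/
def normHypersurface {d : ℕ} {K : Type*} [Field K] [NumberField K]
    (b : Module.Basis (Fin d) ℚ K) : MvPolynomial (Option (Fin d)) LaurentQ :=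
  rename some (map (HahnSeries.C : ℚ →+* LaurentQ) (normForm b)) - C LaurentQ.t * X none ^ d

/-- The restriction of a form `h` to the plane parametrized by the matrix `A`, that is, `h` with the
linear form `∑ j, A i j * X j` substituted for each variable `i`. -/
def planeSection {k : Type*} [Field k] {ι : Type*} (h : MvPolynomial ι k)
    (A : Matrix ι (Fin 3) k) : MvPolynomial (Fin 3) k :=
  bind₁ (fun i => ∑ j, C (A i j) * X j) h

end

/-! Both `F^ab` and `ℚ^ab((t^(1/2)))` embed in the field `H` of Hahn series in `t` with rational
exponents and algebraic coefficients, and in both cases the image consists of series with exponents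
in `½ℤ` and coefficients in `ℚ^ab` (`IsHalfAb`). For `F^ab` this uses that `H` is algebraically
closed (`HahnSeries.isAlgClosed`), so that an algebraic closure of `F` embeds in it, and that `H`
has many endomorphisms over `F`: the Galois group of `ℚ` acting on coefficients, and the twist `t^q
↦ exp(2πiq) t^q`. Endomorphisms over `F` commute on `F^ab`. Commutation of the Galois actions forces
coefficients into `ℚ^ab`; commutation with the twist forces `exp(2πiq)` to be rational for every
exponent `q` that occurs (`exists_maximalAbelianExtension_toHahn`).

Suppose `N(x) = t z^d` with such series, and let `m` be the least order among the `xᵢ`. The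
coefficients at `t^m` form a nonzero vector over `ℚ^ab`. The commutator subgroup of `S_d`, `d ≥ 3`,
is transitive on the embeddings of `K`, so a conjugate linear factor of `N` vanishing there would
make all of them vanish, against the nonzero discriminant. Hence `N(x)` has order `d m = 1 + d ord
z` with `m` and `ord z` in `½ℤ`, so `d` divides `2` (`eq_zero_of_prod_embedding_eq`). This excludes
points on every plane section of rank `3`.

Smoothness of a general section is the nonvanishing of a Macaulay determinant, which is a nonzero
polynomial because some plane over the algebraic closure cuts out a Fermat curve
(`exists_general_nonsingular`). Irreducibility follows, since two components would meet in a
singular point. Fields with group `S_d` come from `X^d - X - 1` (`exists_isSymmetricNumberField`).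
The genus of a quartic is read off from `0 → 𝒪(-4) → 𝒪 → 𝒪_C → 0`, written with explicit Laurent
polynomial cochains (`PlaneCech.finrank_H1`). -/

noncomputable section

/-! ### Complete ultrametric fields of residue characteristic zero that are algebraically closed -/

section AlgClosed

open Polynomial in
-- Up to sign the trace is a positive integer, of norm `1`, times the second coefficient of the
-- minimal polynomial; the norm of that coefficient is one of the terms whose supremum is the
-- spectral norm.
theorem norm_trace_le_spectralNorm {M E : Type*} [NontriviallyNormedField M] [IsUltrametricDist M]
    [Field E] [Algebra M E] [FiniteDimensional M E]
    (hnat : ∀ n : ℕ, n ≠ 0 → ‖(n : M)‖ = 1) (x : E) :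
    ‖Algebra.trace M E x‖ ≤ spectralNorm M E x := by
  have hx : IsIntegral M x := Algebra.IsIntegral.isIntegral x
  have hdeg : 0 < (minpoly M x).natDegree := minpoly.natDegree_pos hx
  have hfin : Module.finrank (IntermediateField.adjoin M {x}) E ≠ 0 := Module.finrank_pos.ne'
  rw [trace_eq_finrank_mul_minpoly_nextCoeff, norm_mul, hnat _ hfin, norm_neg, one_mul]
  have h := le_ciSup (spectralValueTerms_bddAbove (minpoly M x)) ((minpoly M x).natDegree - 1)
  rw [spectralValueTerms_of_lt_natDegree _ (by omega)] at h
  rw [nextCoeff_of_natDegree_pos hdeg]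
  have e : ((minpoly M x).natDegree : ℝ) - ((minpoly M x).natDegree - 1 : ℕ) = 1 := by
    rw [Nat.cast_sub (by omega)]; simp
  rw [e] at h
  simpa [spectralNorm, spectralValue] using h

open Polynomial in
-- A root `y` of an irreducible polynomial is shifted to have trace zero. If the result `y'` is
-- nonzero, divisibility of the value group and a root in the residue field give an element `c a` of
-- the base with `|y' - c a| < |y'|`. Since `y'` has trace zero, the trace of the difference is `-n
-- c a`, so `|c a| < |y'|` too, which contradicts the ultrametric inequality.
theorem isAlgClosed_of_complete_of_residue {M : Type*} [NontriviallyNormedField M]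
    [CompleteSpace M] [IsUltrametricDist M]
    (hnat : ∀ n : ℕ, n ≠ 0 → ‖(n : M)‖ = 1)
    (hdiv : ∀ x : M, ∀ n : ℕ, n ≠ 0 → ∃ c : M, ‖c‖ ^ n = ‖x‖)
    (hres : ∀ p : M[X], p.Monic → p.natDegree ≠ 0 → (∀ i, ‖p.coeff i‖ ≤ 1) →
      ∃ a : M, ‖p.eval a‖ < 1) : IsAlgClosed M := by
  refine IsAlgClosed.of_exists_root _ fun p hpm hpi => ?_
  have : Fact (Irreducible p) := ⟨hpi⟩
  let E := AdjoinRoot p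
  have : FiniteDimensional M E := (AdjoinRoot.powerBasis hpi.ne_zero).finite
  set n := Module.finrank M E with hn
  have hn0 : n ≠ 0 := Module.finrank_pos.ne'
  have hnM : (n : M) ≠ 0 := fun h => by
    have := hnat n hn0
    rw [h, norm_zero] at this
    exact zero_ne_one this
  let y : E := AdjoinRoot.root p
  let b : M := Algebra.trace M E y / n
  let y' : E := y - algebraMap M E b
  have htr : Algebra.trace M E y' = 0 := by
    simp only [y', map_sub, Algebra.trace_algebraMap, b, ← hn, nsmul_eq_mul]
    field_simp
    ring
  by_cases hy' : y' = 0
  · refine ⟨b, ?_⟩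
    have h1 : aeval y p = 0 := by
      rw [AdjoinRoot.aeval_eq, AdjoinRoot.mk_self]
    rw [show y = algebraMap M E b from sub_eq_zero.1 hy', Polynomial.aeval_algebraMap_apply] at h1
    exact (map_eq_zero_iff _ (algebraMap M E).injective).1 h1
  exfalso
  have hint : ∀ x : E, IsIntegral M x := fun x => Algebra.IsIntegral.isIntegral x
  have hpow : ∀ x : E, spectralNorm M E x ^ (minpoly M x).natDegree = ‖(minpoly M x).coeff 0‖ := by
    intro x
    have hd := (minpoly.natDegree_pos (hint x)).ne'
    rw [spectralNorm.spectralNorm_eq_norm_coeff_zero_rpow, ← Real.rpow_natCast,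
      ← Real.rpow_mul (norm_nonneg _), one_div_mul_cancel (by exact_mod_cast hd), Real.rpow_one]
  obtain ⟨c, hc⟩ := hdiv ((minpoly M y').coeff 0) _ (minpoly.natDegree_pos (hint y')).ne'
  have hcy : spectralNorm M E y' = ‖c‖ := by
    rw [← hpow] at hc
    exact ((pow_left_inj₀ (norm_nonneg c) (spectralNorm_nonneg _)
      (minpoly.natDegree_pos (hint y')).ne').1 hc).symm
  have hc0 : 0 < ‖c‖ := hcy ▸ spectralNorm_zero_lt hy' (hint y').isAlgebraic
  have hcne : c ≠ 0 := norm_pos_iff.1 hc0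
  let u : E := c⁻¹ • y'
  have hu : spectralNorm M E u = 1 := by
    rw [spectralNorm_smul _ (hint y').isAlgebraic, hcy, coe_nnnorm, norm_inv, inv_mul_cancel₀ hc0.ne']
  obtain ⟨a, ha⟩ := hres (minpoly M u) (minpoly.monic (hint u))
    (minpoly.natDegree_pos (hint u)).ne'
    (fun i => (spectralValue_le_one_iff (minpoly.monic (hint u))).1 hu.le i)
  -- The constant coefficient of the minimal polynomial of `u - a` is the value at `a` of that of
  -- `u`, and its norm is a power of the spectral norm.
  have hua : spectralNorm M E (u - algebraMap M E a) < 1 := by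
    have h1 := hpow (u - algebraMap M E a)
    have h2 : (minpoly M (u - algebraMap M E a)).coeff 0 = (minpoly M u).eval a := by
      rw [minpoly.sub_algebraMap, coeff_zero_eq_eval_zero, eval_comp]; simp
    rw [h2] at h1
    by_contra hcon
    exact absurd (h1 ▸ one_le_pow₀ (not_lt.1 hcon)) (not_le.2 ha)
  have hya : spectralNorm M E (y' - algebraMap M E (c * a)) < ‖c‖ := by
    have : y' - algebraMap M E (c * a) = c • (u - algebraMap M E a) := by
      rw [smul_sub, smul_inv_smul₀ hcne, map_mul, Algebra.smul_def]
    rw [this, spectralNorm_smul _ (hint _).isAlgebraic, coe_nnnorm]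
    nlinarith
  have hca : ‖c * a‖ < ‖c‖ := by
    have h1 := norm_trace_le_spectralNorm hnat (y' - algebraMap M E (c * a))
    rw [map_sub, htr, Algebra.trace_algebraMap, zero_sub, norm_neg, nsmul_eq_mul, norm_mul,
      hnat _ hn0, one_mul] at h1
    exact h1.trans_lt hya
  have h3 := isNonarchimedean_spectralNorm (K := M) (L := E) (y' - algebraMap M E (c * a))
    (algebraMap M E (c * a))
  rw [sub_add_cancel, spectralNorm_extends, hcy] at h3
  exact absurd h3 (not_le.2 (max_lt hya hca))

end AlgClosed

/-! ### Hahn series with rational exponents: norm, completeness, algebraic closedness -/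

namespace HahnSeries

variable (k : Type*) [Field k]

open Classical in
/-- The absolute value `x ↦ exp (-order x)` on the field of Hahn series with rational exponents. -/
def expNegOrder : AbsoluteValue (HahnSeries ℚ k) ℝ where
  toFun x := if x = 0 then 0 else Real.exp (-(x.order : ℝ))
  map_mul' x y := by
    by_cases hx : x = 0
    · simp [hx]
    by_cases hy : y = 0
    · simp [hy]
    simp only [hx, hy, mul_eq_zero, or_self, if_false, order_mul hx hy, ← Real.exp_add]
    congr 1
    push_cast
    ring
  nonneg' x := by
    split_ifs <;> positivity
  eq_zero' x := by
    by_cases hx : x = 0 <;> simp [hx, Real.exp_ne_zero]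
  add_le' x y := by
    by_cases hx : x = 0
    · simp [hx]
    by_cases hy : y = 0
    · simp [hy]
    by_cases hxy : x + y = 0
    · simp only [hxy, if_true]
      split_ifs
      positivity
    simp only [hx, hy, hxy, if_false]
    rcases min_le_iff.1 (min_order_le_order_add hxy) with h | h
    · have : Real.exp (-((x + y).order : ℝ)) ≤ Real.exp (-(x.order : ℝ)) := by
        rw [Real.exp_le_exp]; simpa using h
      linarith [Real.exp_pos (-(y.order : ℝ))]
    · have : Real.exp (-((x + y).order : ℝ)) ≤ Real.exp (-(y.order : ℝ)) := by
        rw [Real.exp_le_exp]; simpa using h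
      linarith [Real.exp_pos (-(x.order : ℝ))]

theorem expNegOrder_apply {x : HahnSeries ℚ k} (hx : x ≠ 0) :
    expNegOrder k x = Real.exp (-(x.order : ℝ)) := by
  classical
  exact if_neg hx

theorem expNegOrder_lt_iff (x : HahnSeries ℚ k) (q : ℚ) :
    expNegOrder k x < Real.exp (-(q : ℝ)) ↔ ∀ r ≤ q, x.coeff r = 0 := by
  by_cases hx : x = 0
  · simp [hx, Real.exp_pos]
  rw [expNegOrder_apply k hx, Real.exp_lt_exp, neg_lt_neg_iff, Rat.cast_lt]
  refine ⟨fun h r hr => coeff_eq_zero_of_lt_order (hr.trans_lt h), fun h => ?_⟩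
  by_contra hcon
  exact hx (coeff_order_eq_zero.1 (h _ (not_lt.1 hcon)))

theorem expNegOrder_le_one_iff (x : HahnSeries ℚ k) :
    expNegOrder k x ≤ 1 ↔ 0 ≤ x.order := by
  -- The order of `0` is `0` by convention, so both sides hold here.
  by_cases hx : x = 0
  · simp [hx]
  rw [expNegOrder_apply k hx, Real.exp_le_one_iff]
  simp

theorem expNegOrder_add_le (x y : HahnSeries ℚ k) :
    expNegOrder k (x + y) ≤ max (expNegOrder k x) (expNegOrder k y) := by
  by_cases hxy : x + y = 0
  · simp [hxy]
  by_cases hx : x = 0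
  · simp [hx]
  by_cases hy : y = 0
  · simp [hy]
  rw [expNegOrder_apply k hx, expNegOrder_apply k hy, expNegOrder_apply k hxy, le_max_iff,
    Real.exp_le_exp, Real.exp_le_exp]
  simpa using min_order_le_order_add hxy

/-- The norm `exp (-order x)` on Hahn series with rational exponents. -/
@[reducible] def nontriviallyNormedField : NontriviallyNormedField (HahnSeries ℚ k) :=
  { (expNegOrder k).toNormedField with
    non_trivial := ⟨single (-1) 1, by
      change 1 < expNegOrder k _
      rw [expNegOrder_apply k (by simp), order_single one_ne_zero]
      simp⟩ }

/-- A sequence of Hahn series such that all coefficients up to any bound are eventually constant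
has a limit. -/
theorem exists_limit_of_eventually_constant (u : ℕ → HahnSeries ℚ k) (N : ℚ → ℕ)
    (hN : ∀ q, ∀ m ≥ N q, ∀ r ≤ q, (u m).coeff r = (u (N q)).coeff r) :
    ∃ x : HahnSeries ℚ k, ∀ q, ∀ m ≥ N q, ∀ r ≤ q, (u m).coeff r = x.coeff r := by
  have key : ∀ q r, r ≤ q → (u (N r)).coeff r = (u (N q)).coeff r := fun q r hr =>
    (hN r (max (N r) (N q)) (le_max_left _ _) r le_rfl).symm.trans
      (hN q (max (N r) (N q)) (le_max_right _ _) r hr)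
  refine ⟨⟨fun q => (u (N q)).coeff q, ?_⟩, fun q m hm r hr =>
    (hN q m hm r hr).trans (key q r hr).symm⟩
  -- A sequence in the support either has a later term above `f 0`, or stays below `f 0`; then it
  -- lies in the support of the single series `u (N (f 0))`.
  intro f
  by_cases h : ∃ n, f 0 < f (n + 1)
  · obtain ⟨n, hn⟩ := h
    exact ⟨0, n + 1, by simp, hn.le⟩
  · push Not at h
    have h' : ∀ n, f n ≤ f 0 := fun n => by cases n; exacts [le_rfl, h _]
    exact (u (N (f 0))).isPWO_support fun n => ⟨f n, by
      rw [mem_support, ← key _ _ (h' n)]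
      exact (f n).2⟩

theorem completeSpace : @CompleteSpace (HahnSeries ℚ k)
    (nontriviallyNormedField k).toUniformSpace := by
  let _ := nontriviallyNormedField k
  refine Metric.complete_of_cauchySeq_tendsto fun u hu => ?_
  have hdist : ∀ x y : HahnSeries ℚ k, dist x y = expNegOrder k (x - y) := fun x y => by
    rw [dist_eq_norm]
    rfl
  rw [Metric.cauchySeq_iff'] at hu
  choose! N' hN' using hu
  obtain ⟨x, hx⟩ := exists_limit_of_eventually_constant k u (fun q => N' (Real.exp (-(q : ℝ))))
    fun q m hm r hr => by
      have := hN' _ (Real.exp_pos (-(q : ℝ))) m hm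
      rw [hdist, expNegOrder_lt_iff] at this
      simpa [sub_eq_zero] using this r hr
  refine ⟨x, Metric.tendsto_atTop.2 fun ε hε => ?_⟩
  obtain ⟨q, hq⟩ := exists_rat_gt (-Real.log ε)
  have hqε : Real.exp (-(q : ℝ)) < ε := by
    rw [← Real.lt_log_iff_exp_lt hε]
    linarith
  refine ⟨N' (Real.exp (-(q : ℝ))), fun m hm => lt_trans ?_ hqε⟩
  rw [hdist, expNegOrder_lt_iff]
  intro r hr
  rw [coeff_sub, hx q m hm r hr, sub_self]

theorem order_nonneg_pow_coeff_zero {x : HahnSeries ℚ k} (hx : 0 ≤ x.order) (a : k) (n : ℕ) :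
    0 ≤ (x * single 0 a ^ n).order := by
  by_cases h : x * single 0 a ^ n = 0
  · rw [h, order_zero]
  rw [order_mul (left_ne_zero_of_mul h) (right_ne_zero_of_mul h), order_pow]
  have : (single (0 : ℚ) a).order = 0 := order_C
  simpa [this] using hx

/-- The field of Hahn series with rational exponents over an algebraically closed field of
characteristic zero is algebraically closed. -/
instance isAlgClosed [IsAlgClosed k] [CharZero k] : IsAlgClosed (HahnSeries ℚ k) := by
  let _ := nontriviallyNormedField k
  have := completeSpace k
  have hnorm : ∀ x : HahnSeries ℚ k, ‖x‖ = expNegOrder k x := fun x => rfl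
  have : IsUltrametricDist (HahnSeries ℚ k) :=
    IsUltrametricDist.isUltrametricDist_of_forall_norm_add_le_max_norm
      fun x y => expNegOrder_add_le k x y
  refine isAlgClosed_of_complete_of_residue ?_ ?_ ?_
  · intro n hn
    have h : (n : HahnSeries ℚ k) = single 0 (n : k) := (single_zero_natCast n).symm
    rw [hnorm, h, expNegOrder_apply k (by simpa using hn), order_single (by simpa using hn)]
    simp
  · intro x n hn
    by_cases hx : x = 0
    · exact ⟨0, by simp [hx, hn]⟩
    refine ⟨single (x.order / n) 1, ?_⟩
    rw [hnorm, hnorm, ← map_pow, single_pow, one_pow, expNegOrder_apply k (by simp),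
      expNegOrder_apply k hx, order_single one_ne_zero]
    have : n • (x.order / n) = x.order := by
      rw [nsmul_eq_mul]
      field_simp
    rw [this]
  · intro p hp hd hint
    have hint' : ∀ i, 0 ≤ (p.coeff i).order := fun i =>
      (expNegOrder_le_one_iff k _).1 (hint i)
    -- The reduction of `p` to the residue field `k`, monic of the same degree; at a root of it the
    -- constant term of the value of `p` vanishes.
    let q : Polynomial k := ∑ i ∈ Finset.range (p.natDegree + 1),
      Polynomial.C ((p.coeff i).coeff 0) * Polynomial.X ^ i
    have hqd : q.coeff p.natDegree = 1 := by
      simp only [q, Polynomial.finsetSum_coeff, Polynomial.coeff_C_mul_X_pow]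
      rw [Finset.sum_eq_single p.natDegree]
      · simp [hp.leadingCoeff]
      · intro b _ hb
        simp [hb.symm]
      · simp
    obtain ⟨a, ha⟩ := IsAlgClosed.exists_root q (fun h => by
      rw [Polynomial.eq_C_of_degree_eq_zero h, Polynomial.coeff_C, if_neg hd] at hqd
      exact zero_ne_one hqd)
    refine ⟨single 0 a, ?_⟩
    have : (1 : ℝ) = Real.exp (-((0 : ℚ) : ℝ)) := by simp
    rw [hnorm, this, expNegOrder_lt_iff]
    intro r hr
    rw [Polynomial.eval_eq_sum_range, coeff_sum]
    rcases hr.lt_or_eq with hr | rfl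
    · exact Finset.sum_eq_zero fun i _ => coeff_eq_zero_of_lt_order
        (hr.trans_le (order_nonneg_pow_coeff_zero k (hint' i) a i))
    · have h1 : ∀ i, (p.coeff i * single 0 a ^ i).coeff 0 = (p.coeff i).coeff 0 * a ^ i := by
        intro i
        rw [single_pow, smul_zero, coeff_mul_single_zero]
      simp only [h1]
      have h2 : q.eval a = 0 := ha
      simpa [q, Polynomial.eval_finsetSum] using h2

end HahnSeries

/-- Among the propositionally equal `ℚ`-algebra structures, this fixes the one that
`maximalAbelianExtension ℚ` is built on. -/
instance ratAlgClosureAlgebra : Algebra ℚ (AlgebraicClosure ℚ) := AlgebraicClosure.instAlgebra ℚ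

/-! ### The maximal abelian extension and commuting endomorphisms -/

section AbelianExtension

theorem exists_ringHom_extends {K Ω : Type*} [Field K] [Field Ω] [IsAlgClosed Ω] (φ : K →+* Ω) :
    ∃ ι : AlgebraicClosure K →+* Ω, ι.comp (algebraMap K (AlgebraicClosure K)) = φ := by
  let _ := φ.toAlgebra
  exact ⟨(IsAlgClosed.lift : AlgebraicClosure K →ₐ[K] Ω).toRingHom, by
    ext x
    exact (IsAlgClosed.lift : AlgebraicClosure K →ₐ[K] Ω).commutes x⟩

/-- A normal extension is stable under `K`-endomorphisms of `Ω`, and the restrictions lie in a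
commutative Galois group. -/
theorem algHom_comp_comm_of_isAbelianGalois {K E Ω : Type*} [Field K] [Field E] [Field Ω]
    [Algebra K E] [Algebra K Ω] [IsAbelianGalois K E] (ι : E →ₐ[K] Ω) (σ τ : Ω →ₐ[K] Ω) (x : E) :
    σ (τ (ι x)) = τ (σ (ι x)) := by
  let _ : Algebra E Ω := ι.toRingHom.toAlgebra
  have : IsScalarTower K E Ω := IsScalarTower.of_algebraMap_eq fun z => (ι.commutes z).symm
  have hι : ∀ z, algebraMap E Ω z = ι z := fun _ => rfl
  have h : σ.restrictNormal' E * τ.restrictNormal' E = τ.restrictNormal' E * σ.restrictNormal' E :=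
    mul_comm' _ _
  have h' : σ.restrictNormal E (τ.restrictNormal E x) = τ.restrictNormal E (σ.restrictNormal E x) :=
    DFunLike.congr_fun h x
  rw [← hι, ← AlgHom.restrictNormal_commutes τ E x, ← AlgHom.restrictNormal_commutes σ E,
    ← AlgHom.restrictNormal_commutes σ E x, ← AlgHom.restrictNormal_commutes τ E, h']

/-- Endomorphisms over `K` commute on the maximal abelian extension of `K`. -/
theorem commute_on_maximalAbelianExtension {K Ω : Type*} [Field K] [Field Ω]
    (ι : AlgebraicClosure K →+* Ω) (σ τ : Ω →+* Ω)
    (hσ : ∀ x, σ (ι (algebraMap K _ x)) = ι (algebraMap K _ x))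
    (hτ : ∀ x, τ (ι (algebraMap K _ x)) = ι (algebraMap K _ x))
    {y : AlgebraicClosure K} (hy : y ∈ maximalAbelianExtension K) :
    σ (τ (ι y)) = τ (σ (ι y)) := by
  let _ : Algebra K Ω := (ι.comp (algebraMap K (AlgebraicClosure K))).toAlgebra
  let ι' : AlgebraicClosure K →ₐ[K] Ω := { ι with commutes' := fun _ => rfl }
  let σ' : Ω →ₐ[K] Ω := { σ with commutes' := hσ }
  let τ' : Ω →ₐ[K] Ω := { τ with commutes' := hτ }
  -- The elements on which the two composites agree form a field, so it is enough that it contains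
  -- each abelian extension in the compositum.
  let E₀ : IntermediateField K (AlgebraicClosure K) :=
    { AlgHom.equalizer ((σ'.comp τ').comp ι') ((τ'.comp σ').comp ι') with
      inv_mem' := fun x hx => by
        have hx' : ((σ'.comp τ').comp ι') x = ((τ'.comp σ').comp ι') x := hx
        change ((σ'.comp τ').comp ι') x⁻¹ = ((τ'.comp σ').comp ι') x⁻¹
        rw [map_inv₀, map_inv₀, hx'] }
  have h : maximalAbelianExtension K ≤ E₀ := iSup_le fun E x hx => by
    have := E.2
    exact algHom_comp_comm_of_isAbelianGalois (ι'.comp E.1.val) σ' τ' ⟨x, hx⟩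
  exact h hy

/-- The elements on which all automorphisms commute form a field. Conjugating `σ` and `τ` shows it
to be Galois stable, hence normal, and its Galois group is commutative because automorphisms lift.
-/
theorem mem_maximalAbelianExtension_of_commute {K : Type*} [Field K] [PerfectField K]
    {a : AlgebraicClosure K}
    (ha : ∀ σ τ : Gal(AlgebraicClosure K/K), σ (τ a) = τ (σ a)) :
    a ∈ maximalAbelianExtension K := by
  let E : IntermediateField K (AlgebraicClosure K) :=
    { carrier := {x | ∀ σ τ : Gal(AlgebraicClosure K/K), σ (τ x) = τ (σ x)}
      mul_mem' := fun hx hy σ τ => by simp only [map_mul, hx σ τ, hy σ τ]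
      add_mem' := fun hx hy σ τ => by simp only [map_add, hx σ τ, hy σ τ]
      algebraMap_mem' := fun x σ τ => by simp
      inv_mem' := fun x hx σ τ => by simp only [map_inv₀, hx σ τ] }
  have hn : Normal K E := by
    refine IntermediateField.normal_iff_forall_map_le'.2 fun ρ => ?_
    rintro _ ⟨x, hx, rfl⟩ σ τ
    have := congrArg ρ (hx (ρ⁻¹ * σ * ρ) (ρ⁻¹ * τ * ρ))
    simpa using this
  have hab : IsAbelianGalois K E :=
    { is_comm := ⟨fun σ τ => by
        obtain ⟨σ, rfl⟩ := AlgEquiv.restrictNormalHom_surjective (AlgebraicClosure K) σ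
        obtain ⟨τ, rfl⟩ := AlgEquiv.restrictNormalHom_surjective (AlgebraicClosure K) τ
        ext x
        simp only [AlgEquiv.mul_apply, AlgEquiv.restrictNormalHom_apply]
        exact x.2 σ τ⟩ }
  exact (le_iSup (fun E : {E : IntermediateField K (AlgebraicClosure K) // IsAbelianGalois K E} =>
    E.1) ⟨E, hab⟩) ha

end AbelianExtension

/-! ### Coefficientwise maps and twists of Hahn series -/

namespace HahnSeries

/-- The ring homomorphism of Hahn series rings applying `f` to all coefficients. -/
def mapRingHom {Γ R S : Type*} [AddCommMonoid Γ] [PartialOrder Γ] [IsOrderedCancelAddMonoid Γ]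
    [Semiring R] [Semiring S] (f : R →+* S) : HahnSeries Γ R →+* HahnSeries Γ S where
  toFun x := x.map f
  map_one' := HahnSeries.map_one f.toMonoidWithZeroHom
  map_mul' x y := HahnSeries.map_mul (f : R →ₙ+* S) (x := x) (y := y)
  map_zero' := by ext; simp
  map_add' x y := by ext; simp

@[simp]
theorem coeff_mapRingHom {Γ R S : Type*} [AddCommMonoid Γ] [PartialOrder Γ]
    [IsOrderedCancelAddMonoid Γ] [Semiring R] [Semiring S] (f : R →+* S) (x : HahnSeries Γ R)
    (a : Γ) : (mapRingHom f x).coeff a = f (x.coeff a) := rfl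

/-- The ring homomorphism multiplying the coefficient of index `a` by `χ a`, where `χ` is a
character. -/
def twist {Γ R : Type*} [AddCommMonoid Γ] [PartialOrder Γ] [IsOrderedCancelAddMonoid Γ]
    [CommSemiring R] (χ : Multiplicative Γ →* R) : HahnSeries Γ R →+* HahnSeries Γ R where
  toFun x := ⟨fun a => χ (.ofAdd a) * x.coeff a,
    x.isPWO_support.mono fun a ha => right_ne_zero_of_mul ha⟩
  map_one' := by
    ext a
    by_cases h : a = 0 <;> simp [coeff_one, h]
  map_mul' x y := by
    ext a
    have hx : (⟨fun a => χ (.ofAdd a) * x.coeff a,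
        x.isPWO_support.mono fun a ha => right_ne_zero_of_mul ha⟩ : HahnSeries Γ R).support ⊆
        x.support := fun b hb => right_ne_zero_of_mul hb
    have hy : (⟨fun a => χ (.ofAdd a) * y.coeff a,
        y.isPWO_support.mono fun a ha => right_ne_zero_of_mul ha⟩ : HahnSeries Γ R).support ⊆
        y.support := fun b hb => right_ne_zero_of_mul hb
    rw [coeff_mul_left' x.isPWO_support hx]
    change χ (.ofAdd a) * (x * y).coeff a = _
    rw [coeff_mul, Finset.mul_sum]
    refine Eq.trans ?_ (Finset.sum_subset (Finset.antidiagonal_mono_right (ht := y.isPWO_support) hy)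
      fun p hp hp' => ?_).symm
    · refine Finset.sum_congr rfl fun p hp => ?_
      rw [← (Finset.mem_antidiagonal.1 hp).2.2, ofAdd_add, map_mul]
      ring
    · rw [Finset.mem_antidiagonal] at hp hp'
      by_contra h
      exact hp' ⟨hp.1, right_ne_zero_of_mul h, hp.2.2⟩
  map_zero' := by ext; simp
  map_add' x y := by ext; simp [mul_add]

@[simp]
theorem coeff_twist {Γ R : Type*} [AddCommMonoid Γ] [PartialOrder Γ] [IsOrderedCancelAddMonoid Γ]
    [CommSemiring R] (χ : Multiplicative Γ →* R) (x : HahnSeries Γ R) (a : Γ) :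
    (twist χ x).coeff a = χ (.ofAdd a) * x.coeff a := rfl

end HahnSeries

/-! ### The character `q ↦ exp(2πiq)` with algebraic values -/

section RootsOfUnity

/-- The number on the right is a root of unity of order dividing `q.den`, hence a power of the image
of a primitive root in `k`. -/
theorem exists_map_eq_cexp_two_pi_I_mul {k : Type*} [Field k] [CharZero k] [IsAlgClosed k]
    (j : k →+* ℂ) (q : ℚ) : ∃ z, j z = Complex.exp (2 * Real.pi * Complex.I * q) := by
  have h : Complex.exp (2 * Real.pi * Complex.I * q) ^ q.den = 1 := by
    rw [← Complex.exp_nat_mul, Complex.exp_eq_one_iff]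
    refine ⟨q.num, ?_⟩
    have h1 : (q.den : ℂ) * q = q.num := by
      exact_mod_cast Rat.den_mul_eq_num q
    rw [← h1]
    ring
  have : NeZero (q.den : k) := ⟨by simp⟩
  have : NeZero q.den := ⟨q.den_nz⟩
  obtain ⟨ζ, hζ⟩ := HasEnoughRootsOfUnity.exists_primitiveRoot k q.den
  obtain ⟨i, -, hi⟩ := (hζ.map_of_injective j.injective).eq_pow_of_pow_eq_one h
  exact ⟨ζ ^ i, by rw [map_pow, hi]⟩

/-- An embedding of the algebraic numbers into the complex numbers. -/
def algebraicToComplex : AlgebraicClosure ℚ →+* ℂ :=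
  (exists_ringHom_extends (algebraMap ℚ ℂ)).choose

/-- The character `q ↦ exp (2πiq)` of `ℚ` with values in the algebraic numbers. -/
def ratExp : Multiplicative ℚ →* AlgebraicClosure ℚ where
  toFun q := (exists_map_eq_cexp_two_pi_I_mul algebraicToComplex q.toAdd).choose
  map_one' := algebraicToComplex.injective <| by
    rw [(exists_map_eq_cexp_two_pi_I_mul algebraicToComplex _).choose_spec]
    simp
  map_mul' p q := algebraicToComplex.injective <| by
    rw [map_mul algebraicToComplex,
      (exists_map_eq_cexp_two_pi_I_mul algebraicToComplex (p * q).toAdd).choose_spec,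
      (exists_map_eq_cexp_two_pi_I_mul algebraicToComplex p.toAdd).choose_spec,
      (exists_map_eq_cexp_two_pi_I_mul algebraicToComplex _).choose_spec, ← Complex.exp_add]
    congr 1
    simp [mul_add]

theorem algebraicToComplex_ratExp (q : ℚ) :
    algebraicToComplex (ratExp (.ofAdd q)) = Complex.exp (2 * Real.pi * Complex.I * q) :=
  (exists_map_eq_cexp_two_pi_I_mul algebraicToComplex q).choose_spec

theorem ratExp_intCast (n : ℤ) : ratExp (.ofAdd (n : ℚ)) = 1 := by
  apply algebraicToComplex.injective
  rw [algebraicToComplex_ratExp, map_one, Complex.exp_eq_one_iff]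
  exact ⟨n, by push_cast; ring⟩

/-- A value fixed by the Galois group is rational, hence real, so `sin (2πq) = 0`. -/
theorem exists_two_mul_eq_of_ratExp_fixed (q : ℚ)
    (h : ∀ τ : Gal(AlgebraicClosure ℚ/ℚ), τ (ratExp (.ofAdd q)) = ratExp (.ofAdd q)) :
    ∃ n : ℤ, 2 * q = n := by
  obtain ⟨r, hr⟩ := (InfiniteGalois.mem_range_algebraMap_iff_fixed _).2 h
  have h1 := algebraicToComplex_ratExp q
  rw [← hr, eq_ratCast, map_ratCast] at h1
  have h2 := congrArg Complex.im h1
  have h3 : (2 * Real.pi * Complex.I * q : ℂ) = ((2 * Real.pi * q : ℝ) : ℂ) * Complex.I := by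
    push_cast; ring
  rw [h3, Complex.exp_ofReal_mul_I_im] at h2
  have h4 : Real.sin (2 * Real.pi * q) = 0 := by
    rw [← h2]
    simp
  obtain ⟨n, hn⟩ := Real.sin_eq_zero_iff.1 h4
  refine ⟨n, ?_⟩
  have h5 : (n : ℝ) = 2 * q := by
    have := Real.pi_ne_zero
    apply mul_right_cancel₀ this
    rw [hn]
    ring
  exact_mod_cast h5.symm

end RootsOfUnity

/-! ### The two abelian fields inside the Hahn series -/

section HalfAb

/-- The field of Hahn series with rational exponents and coefficients in the algebraic numbers. -/
abbrev QbarHahn : Type := HahnSeries ℚ (AlgebraicClosure ℚ)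

/-- The embedding of `ℚ((t))` into the field of Hahn series. -/
def LaurentQ.toHahn : LaurentQ →+* QbarHahn :=
  (HahnSeries.embDomainRingHom (Int.castAddHom ℚ) Int.cast_injective (by simp)).comp
    (HahnSeries.mapRingHom (algebraMap ℚ (AlgebraicClosure ℚ)))

theorem LaurentQ.toHahn_t : LaurentQ.toHahn LaurentQ.t = HahnSeries.single 1 1 := by
  have h : HahnSeries.mapRingHom (algebraMap ℚ (AlgebraicClosure ℚ)) LaurentQ.t =
      HahnSeries.single 1 1 := by
    ext n
    by_cases h : n = 1 <;> simp [LaurentQ.t, h]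
  change HahnSeries.embDomain _ (HahnSeries.mapRingHom (algebraMap ℚ (AlgebraicClosure ℚ))
    LaurentQ.t) = _
  rw [h, HahnSeries.embDomain_single]
  simp

/-- Rational coefficients and integral exponents are what make the Galois action on coefficients and
the twist fix the image of `ℚ((t))`. -/
theorem LaurentQ.coeff_toHahn (x : LaurentQ) (q : ℚ) :
    (∃ n : ℤ, q = n ∧ (LaurentQ.toHahn x).coeff q = algebraMap ℚ _ (x.coeff n)) ∨
      (LaurentQ.toHahn x).coeff q = 0 := by
  by_cases h : ∃ n : ℤ, (n : ℚ) = q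
  · obtain ⟨n, rfl⟩ := h
    left
    refine ⟨n, rfl, ?_⟩
    exact HahnSeries.embDomain_coeff (f := ⟨⟨Int.castAddHom ℚ, Int.cast_injective⟩, by simp⟩)
      (x := HahnSeries.mapRingHom (algebraMap ℚ (AlgebraicClosure ℚ)) x)
  · right
    exact HahnSeries.embDomain_of_notMem_range h

/-- The Hahn series in `t ^ (1/2)` with coefficients in `ℚᵃᵇ`. -/
def IsHalfAb (x : QbarHahn) : Prop :=
  ∀ q, x.coeff q ∈ maximalAbelianExtension ℚ ∧ (x.coeff q ≠ 0 → ∃ n : ℤ, 2 * q = n)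

theorem mapRingHom_toHahn (τ : Gal(AlgebraicClosure ℚ/ℚ)) (x : LaurentQ) :
    HahnSeries.mapRingHom (τ : AlgebraicClosure ℚ →+* AlgebraicClosure ℚ) (LaurentQ.toHahn x) =
      LaurentQ.toHahn x := by
  ext q
  rcases LaurentQ.coeff_toHahn x q with ⟨n, -, h⟩ | h <;> simp [h]

theorem twist_toHahn (x : LaurentQ) :
    HahnSeries.twist ratExp (LaurentQ.toHahn x) = LaurentQ.toHahn x := by
  ext q
  rcases LaurentQ.coeff_toHahn x q with ⟨n, rfl, h⟩ | h
  · simp [ratExp_intCast]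
  · simp [h]

/-- An embedding of the algebraic closure exists because the Hahn series field is algebraically
closed; its restriction has the required shape by comparing coefficients in commutation relations.
-/
theorem exists_maximalAbelianExtension_toHahn :
    ∃ ψ : maximalAbelianExtension LaurentQ →+* QbarHahn,
      ψ (algebraMap LaurentQ _ LaurentQ.t) = HahnSeries.single 1 1 ∧ ∀ x, IsHalfAb (ψ x) := by
  obtain ⟨ι, hι⟩ := exists_ringHom_extends LaurentQ.toHahn
  have hι' : ∀ x, ι (algebraMap LaurentQ _ x) = LaurentQ.toHahn x := fun x => by rw [← hι]; rfl
  refine ⟨ι.comp (algebraMap (maximalAbelianExtension LaurentQ) (AlgebraicClosure LaurentQ)),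
    ?_, fun y q => ⟨?_, fun hq => ?_⟩⟩
  · rw [← LaurentQ.toHahn_t, ← hι']
    rfl
  · refine mem_maximalAbelianExtension_of_commute fun σ τ => ?_
    have := commute_on_maximalAbelianExtension ι
      (HahnSeries.mapRingHom (σ : AlgebraicClosure ℚ →+* AlgebraicClosure ℚ))
      (HahnSeries.mapRingHom (τ : AlgebraicClosure ℚ →+* AlgebraicClosure ℚ))
      (fun x => by rw [hι', mapRingHom_toHahn]) (fun x => by rw [hι', mapRingHom_toHahn]) y.2
    exact congrArg (fun x : QbarHahn => x.coeff q) this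
  -- Commuting the twist with `τ` gives `τ(χ(q) c) = χ(q) τ(c)` for the coefficient `c ≠ 0` at `q`,
  -- so `τ` fixes `χ(q)`.
  · refine exists_two_mul_eq_of_ratExp_fixed q fun τ => ?_
    have := commute_on_maximalAbelianExtension ι
      (HahnSeries.mapRingHom (τ : AlgebraicClosure ℚ →+* AlgebraicClosure ℚ))
      (HahnSeries.twist ratExp)
      (fun x => by rw [hι', mapRingHom_toHahn]) (fun x => by rw [hι', twist_toHahn]) y.2
    have h1 := congrArg (fun x : QbarHahn => x.coeff q) this
    have h2 : τ (ratExp (.ofAdd q) * (ι y).coeff q) = ratExp (.ofAdd q) * τ ((ι y).coeff q) := h1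
    rw [map_mul] at h2
    exact mul_right_cancel₀ (by simpa using hq) h2

/-- The embedding of `ℚᵃᵇ((s))` into the field of Hahn series, `s ↦ t ^ (1/2)`. -/
def RatAb.toHahn : LaurentSeries RatAb →+* QbarHahn :=
  (HahnSeries.embDomainRingHom ((AddMonoidHom.mulLeft (1 / 2 : ℚ)).comp (Int.castAddHom ℚ))
    (fun a b h => by simpa using h) (by simp)).comp
    (HahnSeries.mapRingHom (algebraMap RatAb (AlgebraicClosure ℚ)))

theorem RatAb.isHalfAb_toHahn (x : LaurentSeries RatAb) : IsHalfAb (RatAb.toHahn x) := by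
  intro q
  by_cases h : ∃ n : ℤ, (1 / 2 : ℚ) * n = q
  · obtain ⟨n, rfl⟩ := h
    have : (RatAb.toHahn x).coeff ((1 / 2 : ℚ) * n) = algebraMap RatAb _ (x.coeff n) :=
      HahnSeries.embDomain_coeff
        (f := ⟨⟨(AddMonoidHom.mulLeft (1 / 2 : ℚ)).comp (Int.castAddHom ℚ),
          fun a b h => by simpa using h⟩, by simp⟩)
        (x := HahnSeries.mapRingHom (algebraMap RatAb (AlgebraicClosure ℚ)) x)
    rw [this]
    exact ⟨(x.coeff n).2, fun _ => ⟨n, by ring⟩⟩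
  · have : (RatAb.toHahn x).coeff q = 0 := HahnSeries.embDomain_of_notMem_range h
    rw [this]
    exact ⟨zero_mem _, fun h => absurd rfl h⟩

theorem RatAb.toHahn_toCompletedAb_t :
    RatAb.toHahn (LaurentQ.toCompletedAb LaurentQ.t) = HahnSeries.single 1 1 := by
  have h : HahnSeries.mapRingHom (algebraMap RatAb (AlgebraicClosure ℚ)) (HahnSeries.single 1 1) =
      (HahnSeries.single 1 1 : LaurentSeries (AlgebraicClosure ℚ)) := by
    ext n
    by_cases h : n = 1 <;> simp [h]
  have h2 : RatAb.toHahn (HahnSeries.single 1 1) = HahnSeries.single (1 / 2 : ℚ) 1 := by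
    change HahnSeries.embDomain _ (HahnSeries.mapRingHom (algebraMap RatAb (AlgebraicClosure ℚ))
      (HahnSeries.single 1 1)) = _
    rw [h, HahnSeries.embDomain_single]
    simp
  rw [LaurentQ.toCompletedAb_t, map_pow, h2, HahnSeries.single_pow]
  norm_num

end HalfAb

/-! ### Galois action on the embeddings of an `S_d`-field -/

section SymmetricGalois

/-- If the Galois group of the normal closure of `K/F` is as large as the symmetric group of the set
of embeddings of `K`, then every permutation of the embeddings is induced by an automorphism. -/
theorem exists_algEquiv_comp_eq_perm {F K Ω : Type*} [Field F] [Field K] [Field Ω] [Algebra F K]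
    [Algebra F Ω] [Normal F Ω] [Finite (K →ₐ[F] Ω)]
    (hcard : Nat.card Gal(IntermediateField.normalClosure F K Ω/F) =
      Nat.card (Equiv.Perm (K →ₐ[F] Ω))) (π : Equiv.Perm (K →ₐ[F] Ω)) :
    ∃ σ : Gal(Ω/F), ∀ φ : K →ₐ[F] Ω, (σ : Ω →ₐ[F] Ω).comp φ = π φ := by
  let N := IntermediateField.normalClosure F K Ω
  let ρ : Gal(Ω/F) → Equiv.Perm (K →ₐ[F] Ω) := fun σ =>
    { toFun := fun φ => (σ : Ω →ₐ[F] Ω).comp φ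
      invFun := fun φ => (σ⁻¹ : Gal(Ω/F)).toAlgHom.comp φ
      left_inv := fun φ => by ext x; exact σ.symm_apply_apply _
      right_inv := fun φ => by ext x; exact σ.apply_symm_apply _ }
  have hs : Function.Surjective (AlgEquiv.restrictNormalHom (F := F) (K₁ := Ω) N) :=
    AlgEquiv.restrictNormalHom_surjective Ω
  choose lift hlift using hs
  -- The images of the embeddings generate the normal closure, so its group embeds in the
  -- permutations; equal cardinalities then give surjectivity.
  have hinj : Function.Injective (ρ ∘ lift) := by
    intro g h hgh
    have key : ∀ x ∈ N, lift g x = lift h x := by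
      let E₀ : IntermediateField F Ω :=
        { AlgHom.equalizer (lift g : Ω →ₐ[F] Ω) (lift h : Ω →ₐ[F] Ω) with
          inv_mem' := fun x (hx : lift g x = lift h x) => by
            change lift g x⁻¹ = lift h x⁻¹
            rw [map_inv₀, map_inv₀, hx] }
      have : N ≤ E₀ := iSup_le fun φ => by
        rintro _ ⟨x, rfl⟩
        exact DFunLike.congr_fun (DFunLike.congr_fun hgh φ) x
      exact this
    ext x
    rw [← hlift g, ← hlift h, AlgEquiv.restrictNormalHom_apply, AlgEquiv.restrictNormalHom_apply]
    exact key x x.2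
  have hbij := (Nat.bijective_iff_injective_and_card (ρ ∘ lift)).2 ⟨hinj, hcard⟩
  obtain ⟨g, hg⟩ := hbij.2 π
  exact ⟨lift g, fun φ => DFunLike.congr_fun hg φ⟩

/-- Reconciles the Galois groups formed with the different but equal `ℚ`-algebra structures on the
normal closure. -/
theorem card_gal_rat_congr {E : Type*} [Field E] (i j : Algebra ℚ E) :
    Nat.card (@AlgEquiv ℚ E E _ _ _ i i) = Nat.card (@AlgEquiv ℚ E E _ _ _ j j) := by
  rw [Subsingleton.elim i j]

theorem exists_algEquiv_comp_eq_perm_of_isSymmetric {d : ℕ} {K : Type*} [Field K] [NumberField K]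
    (hK : IsSymmetricNumberField d K) (π : Equiv.Perm (K →ₐ[ℚ] AlgebraicClosure ℚ)) :
    ∃ σ : Gal(AlgebraicClosure ℚ/ℚ), ∀ φ : K →ₐ[ℚ] AlgebraicClosure ℚ,
      (σ : AlgebraicClosure ℚ →ₐ[ℚ] AlgebraicClosure ℚ).comp φ = π φ := by
  obtain ⟨hd, ⟨g⟩⟩ := hK
  have : Algebra.IsAlgebraic ℚ (AlgebraicClosure K) := Algebra.IsAlgebraic.trans ℚ K _
  have : IsAlgClosure ℚ (AlgebraicClosure K) := ⟨inferInstance, inferInstance⟩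
  let e : AlgebraicClosure K ≃ₐ[ℚ] AlgebraicClosure ℚ := IsAlgClosure.equiv ℚ _ _
  let E : (K →ₐ[ℚ] AlgebraicClosure K) ≃ (K →ₐ[ℚ] AlgebraicClosure ℚ) :=
    AlgEquiv.arrowCongr AlgEquiv.refl e
  have hcard : Nat.card (K →ₐ[ℚ] AlgebraicClosure K) = d := by
    rw [Nat.card_eq_fintype_card, AlgHom.card, hd]
  obtain ⟨σ, hσ⟩ := exists_algEquiv_comp_eq_perm (F := ℚ) (K := K) (Ω := AlgebraicClosure K) (by
    have h := Nat.card_congr g.toEquiv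
    rw [Nat.card_perm, Nat.card_fin] at h
    rw [Nat.card_perm, hcard, ← h]
    exact card_gal_rat_congr _ _)
    ((E.trans π).trans E.symm)
  refine ⟨(e.symm.trans σ).trans e, fun φ => ?_⟩
  have h1 := hσ (E.symm φ)
  have h2 : E ((σ : AlgebraicClosure K →ₐ[ℚ] AlgebraicClosure K).comp (E.symm φ)) = π φ := by
    rw [h1]
    simp
  rw [← h2]
  ext x
  rfl

/-- The commutator subgroup of the absolute Galois group of `ℚ` acts transitively on the embeddings
of a field of degree `d ≥ 3` with Galois group `S_d`. -/
theorem exists_commutator_comp_eq {d : ℕ} (hd : 3 ≤ d) {K : Type*} [Field K] [NumberField K]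
    (hK : IsSymmetricNumberField d K) (φ₀ φ₁ : K →ₐ[ℚ] AlgebraicClosure ℚ) :
    ∃ γ : Gal(AlgebraicClosure ℚ/ℚ),
      (γ : AlgebraicClosure ℚ →ₐ[ℚ] AlgebraicClosure ℚ).comp φ₀ = φ₁ ∧
      ∀ y ∈ maximalAbelianExtension ℚ, γ y = y := by
  classical
  by_cases h01 : φ₀ = φ₁
  · exact ⟨1, by subst h01; ext; rfl, fun _ _ => rfl⟩
  -- A third embedding exists as `d ≥ 3`. It allows a commutator of two transpositions to be a
  -- `3`-cycle carrying `φ₀` to `φ₁`.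
  obtain ⟨φ₂, h2⟩ : ∃ φ₂, φ₂ ∉ ({φ₀, φ₁} : Finset (K →ₐ[ℚ] AlgebraicClosure ℚ)) := by
    by_contra! hcon
    have h1 : Finset.univ.card ≤ ({φ₀, φ₁} : Finset (K →ₐ[ℚ] AlgebraicClosure ℚ)).card :=
      Finset.card_le_card fun x _ => hcon x
    have h2 := Finset.card_le_two (a := φ₀) (b := φ₁)
    rw [Finset.card_univ, AlgHom.card, hK.1] at h1
    omega
  simp only [Finset.mem_insert, Finset.mem_singleton, not_or] at h2
  obtain ⟨σ, hσ⟩ := exists_algEquiv_comp_eq_perm_of_isSymmetric hK (Equiv.swap φ₀ φ₂)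
  obtain ⟨τ, hτ⟩ := exists_algEquiv_comp_eq_perm_of_isSymmetric hK (Equiv.swap φ₂ φ₁)
  have hσ' := hσ
  have hinv : ∀ ρ : Gal(AlgebraicClosure ℚ/ℚ), ∀ φ ψ : K →ₐ[ℚ] AlgebraicClosure ℚ,
      (ρ : AlgebraicClosure ℚ →ₐ[ℚ] AlgebraicClosure ℚ).comp φ = ψ →
      (ρ⁻¹ : Gal(AlgebraicClosure ℚ/ℚ)).toAlgHom.comp ψ = φ := by
    rintro ρ φ _ rfl
    ext x
    exact ρ.symm_apply_apply _
  have h3 := hinv τ φ₀ φ₀ (by rw [hτ, Equiv.swap_apply_of_ne_of_ne (Ne.symm h2.1) h01])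
  have h4 := hinv σ φ₂ φ₀ (by rw [hσ, Equiv.swap_apply_right])
  have h5 := hτ φ₂
  rw [Equiv.swap_apply_left] at h5
  have h6 := hσ φ₁
  rw [Equiv.swap_apply_of_ne_of_ne (Ne.symm h01) (Ne.symm h2.2)] at h6
  -- From right to left: `φ₀ ↦ φ₀ ↦ φ₂ ↦ φ₁ ↦ φ₁`.
  refine ⟨σ * τ * σ⁻¹ * τ⁻¹, ?_, fun y hy => ?_⟩
  · ext x
    have e3 := DFunLike.congr_fun h3 x
    have e4 := DFunLike.congr_fun h4 x
    have e5 := DFunLike.congr_fun h5 x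
    have e6 := DFunLike.congr_fun h6 x
    change σ (τ (σ⁻¹ (τ⁻¹ (φ₀ x)))) = φ₁ x
    change τ⁻¹ (φ₀ x) = φ₀ x at e3
    change σ⁻¹ (φ₀ x) = φ₂ x at e4
    change τ (φ₂ x) = φ₁ x at e5
    change σ (φ₁ x) = φ₁ x at e6
    rw [e3, e4, e5, e6]
  · have h := commute_on_maximalAbelianExtension (RingHom.id (AlgebraicClosure ℚ))
      ((σ⁻¹ : Gal(AlgebraicClosure ℚ/ℚ)) : AlgebraicClosure ℚ →+* AlgebraicClosure ℚ)
      ((τ⁻¹ : Gal(AlgebraicClosure ℚ/ℚ)) : AlgebraicClosure ℚ →+* AlgebraicClosure ℚ)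
      (fun x => by simp) (fun x => by simp) hy
    change σ⁻¹ (τ⁻¹ y) = τ⁻¹ (σ⁻¹ y) at h
    change σ (τ (σ⁻¹ (τ⁻¹ y))) = y
    rw [h]
    change σ (τ (τ.symm (σ.symm y))) = y
    rw [AlgEquiv.apply_symm_apply, AlgEquiv.apply_symm_apply]

end SymmetricGalois

/-! ### The norm form over `ℚ^ab` and over Hahn series -/

section NormForm

variable {d : ℕ} {K : Type*} [Field K] [NumberField K]

/-- At rational points this is the norm as a product of conjugates, and polynomials that agree on an
infinite grid are equal. -/
theorem map_normForm_eq_prod {E : Type*} [Field E] [IsAlgClosed E] [Algebra ℚ E]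
    (b : Module.Basis (Fin d) ℚ K) :
    map (algebraMap ℚ E) (normForm b) = ∏ φ : K →ₐ[ℚ] E, ∑ i, C (φ (b i)) * X i := by
  have : CharZero E := algebraRat.charZero E
  refine MvPolynomial.funext_set (fun _ => Set.range (algebraMap ℚ E))
    (fun _ => Set.infinite_range_of_injective (algebraMap ℚ E).injective) fun x hx => ?_
  choose y hy using fun i => hx i trivial
  obtain rfl : (fun i => algebraMap ℚ E (y i)) = x := _root_.funext hy
  have h1 : eval (fun i => algebraMap ℚ E (y i)) (map (algebraMap ℚ E) (normForm b)) =
      algebraMap ℚ E (eval y (normForm b)) := by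
    rw [eval_map, eval₂_comp]
    rfl
  rw [h1, eval_normForm, Algebra.norm_eq_prod_embeddings, map_prod]
  refine Finset.prod_congr rfl fun φ _ => ?_
  simp only [map_sum, map_mul, eval_C, eval_X]
  refine Finset.sum_congr rfl fun i _ => ?_
  rw [Algebra.smul_def, map_mul, AlgHom.commutes, mul_comm]

/-- The square of the determinant of the matrix of embeddings is the discriminant, which is nonzero.
-/
theorem eq_zero_of_forall_sum_embedding_eq_zero {E : Type*} [Field E] [IsAlgClosed E]
    [Algebra ℚ E] (b : Module.Basis (Fin d) ℚ K) (x : Fin d → E)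
    (hx : ∀ φ : K →ₐ[ℚ] E, ∑ i, x i * φ (b i) = 0) : x = 0 := by
  have hcard : Fintype.card (Fin d) = Fintype.card (K →ₐ[ℚ] E) := by
    rw [AlgHom.card, Module.finrank_eq_card_basis b]
  have hdet : (Algebra.embeddingsMatrixReindex ℚ E b (Fintype.equivOfCardEq hcard)).det ≠ 0 := by
    intro h0
    have h1 := Algebra.discr_eq_det_embeddingsMatrixReindex_pow_two ℚ E b
      (Fintype.equivOfCardEq hcard)
    rw [h0, zero_pow two_ne_zero, map_eq_zero_iff _ (algebraMap ℚ E).injective] at h1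
    exact Algebra.discr_not_zero_of_basis ℚ b h1
  refine Matrix.eq_zero_of_vecMul_eq_zero hdet ?_
  ext j
  exact hx _

/-- Automorphisms fixing `ℚ^ab` permute the embeddings transitively, so one vanishing conjugate form
at `x` would make all of them vanish. -/
theorem sum_embedding_ne_zero (hd : 3 ≤ d) (hK : IsSymmetricNumberField d K)
    (b : Module.Basis (Fin d) ℚ K) {x : Fin d → AlgebraicClosure ℚ} (hx0 : x ≠ 0)
    (hx : ∀ i, x i ∈ maximalAbelianExtension ℚ) (φ : K →ₐ[ℚ] AlgebraicClosure ℚ) :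
    ∑ i, x i * φ (b i) ≠ 0 := by
  intro h0
  refine hx0 (eq_zero_of_forall_sum_embedding_eq_zero b x fun ψ => ?_)
  obtain ⟨γ, hγ, hfix⟩ := exists_commutator_comp_eq hd hK φ ψ
  have h1 := congrArg γ h0
  rw [map_zero, map_sum] at h1
  rw [← h1]
  refine Finset.sum_congr rfl fun i _ => ?_
  rw [map_mul, hfix _ (hx i), ← hγ]
  rfl

/-- The hypersurface `N(x) = t z ^ d` has no points with coordinates in `ℚᵃᵇ((t ^ (1/2)))`. -/
theorem eq_zero_of_prod_embedding_eq (hd : 3 ≤ d) (hK : IsSymmetricNumberField d K)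
    (b : Module.Basis (Fin d) ℚ K) {x : Fin d → QbarHahn} {z : QbarHahn}
    (hx : ∀ i, IsHalfAb (x i)) (hz : IsHalfAb z)
    (h : ∏ φ : K →ₐ[ℚ] AlgebraicClosure ℚ, ∑ i, HahnSeries.C (φ (b i)) * x i =
      HahnSeries.single 1 1 * z ^ d) : x = 0 ∧ z = 0 := by
  by_cases hx0 : x = 0
  · refine ⟨hx0, ?_⟩
    have : Nonempty (K →ₐ[ℚ] AlgebraicClosure ℚ) := by
      rw [← Fintype.card_pos_iff, AlgHom.card, hK.1]
      omega
    simp only [hx0, Pi.zero_apply, mul_zero, Finset.sum_const_zero, Finset.prod_const,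
      Finset.card_univ] at h
    rw [zero_pow Fintype.card_ne_zero, eq_comm, mul_eq_zero] at h
    exact eq_zero_of_pow_eq_zero (h.resolve_left (by simp))
  exfalso
  classical
  obtain ⟨i₁, hi₁⟩ := Function.ne_iff.1 hx0
  obtain ⟨i₀, hi₀, hmin⟩ := Finset.exists_min_image (Finset.univ.filter fun i => x i ≠ 0)
    (fun i => (x i).order) ⟨i₁, by simpa using hi₁⟩
  simp only [Finset.mem_filter, Finset.mem_univ, true_and] at hi₀ hmin
  set m := (x i₀).order with hm
  have hlead : (x i₀).coeff m ≠ 0 := fun h => hi₀ (HahnSeries.coeff_order_eq_zero.1 h)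
  have hlow : ∀ i, ∀ q < m, (x i).coeff q = 0 := fun i q hq => by
    by_cases hi : x i = 0
    · simp [hi]
    · exact HahnSeries.coeff_eq_zero_of_lt_order (hq.trans_le (hmin i hi))
  have hcoeff : ∀ (φ : K →ₐ[ℚ] AlgebraicClosure ℚ) (q : ℚ),
      (∑ i, HahnSeries.C (φ (b i)) * x i).coeff q = ∑ i, (x i).coeff q * φ (b i) := by
    intro φ q
    rw [HahnSeries.coeff_sum]
    refine Finset.sum_congr rfl fun i _ => ?_
    rw [HahnSeries.C_mul_eq_smul, HahnSeries.coeff_smul, smul_eq_mul, mul_comm]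
  -- No cancellation at the lowest exponent `m`: the coefficient is a conjugate form evaluated at a
  -- nonzero vector over `ℚ^ab`.
  have hne : ∀ φ : K →ₐ[ℚ] AlgebraicClosure ℚ,
      (∑ i, HahnSeries.C (φ (b i)) * x i).coeff m ≠ 0 := by
    intro φ
    rw [hcoeff]
    exact sum_embedding_ne_zero hd hK b (Function.ne_iff.2 ⟨i₀, hlead⟩) (fun i => (hx i m).1) φ
  have hne' : ∀ φ : K →ₐ[ℚ] AlgebraicClosure ℚ, ∑ i, HahnSeries.C (φ (b i)) * x i ≠ 0 :=
    fun φ => HahnSeries.ne_zero_of_coeff_ne_zero (hne φ)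
  have hord : ∀ φ : K →ₐ[ℚ] AlgebraicClosure ℚ,
      (∑ i, HahnSeries.C (φ (b i)) * x i).order = m := by
    intro φ
    refine le_antisymm (HahnSeries.order_le_of_coeff_ne_zero (hne φ)) ?_
    by_contra hlt
    have h0 : (∑ i, HahnSeries.C (φ (b i)) * x i).coeff
        (∑ i, HahnSeries.C (φ (b i)) * x i).order = 0 := by
      rw [hcoeff]
      exact Finset.sum_eq_zero fun i _ => by rw [hlow i _ (not_le.1 hlt), zero_mul]
    exact hne' φ (HahnSeries.coeff_order_eq_zero.1 h0)
  have hprod : ∀ s : Finset (K →ₐ[ℚ] AlgebraicClosure ℚ),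
      (∏ φ ∈ s, ∑ i, HahnSeries.C (φ (b i)) * x i).order = s.card * m := by
    classical
    intro s
    induction s using Finset.induction_on with
    | empty => simp
    | insert φ s hφ ih =>
      rw [Finset.prod_insert hφ, HahnSeries.order_mul (hne' φ)
        (Finset.prod_ne_zero_iff.2 fun φ _ => hne' φ), ih, hord, Finset.card_insert_of_notMem hφ]
      push_cast
      ring
  have hz0 : z ≠ 0 := by
    rintro rfl
    rw [zero_pow (by omega), mul_zero] at h
    exact Finset.prod_ne_zero_iff.2 (fun φ _ => hne' φ) h
  have h1 := congrArg HahnSeries.order h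
  rw [hprod, HahnSeries.order_mul (by simp) (pow_ne_zero _ hz0), HahnSeries.order_pow,
    HahnSeries.order_single one_ne_zero, Finset.card_univ, AlgHom.card, hK.1, nsmul_eq_mul] at h1
  obtain ⟨k, hk⟩ := (hx i₀ m).2 hlead
  obtain ⟨l, hl⟩ := (hz z.order).2 fun h => hz0 (HahnSeries.coeff_order_eq_zero.1 h)
  -- Twice the equation `d m = 1 + d ord z`, with `k = 2 m` and `l = 2 ord z` integers.
  have h2 : (d : ℤ) * (k - l) = 2 := by
    have : (d : ℚ) * (k - l) = 2 := by
      rw [← hk, ← hl]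
      linear_combination 2 * h1
    exact_mod_cast this
  have h3 : (d : ℤ) ∣ 2 := ⟨_, h2.symm⟩
  have h4 := Int.le_of_dvd two_pos h3
  omega

end NormForm

/-! ### Plane sections have no abelian points -/

section NoAbelianPoints

theorem eval₂_planeSection {k L ι : Type*} [Field k] [Field L] (φ : k →+* L)
    (h : MvPolynomial ι k) (A : Matrix ι (Fin 3) k) (v : Fin 3 → L) :
    eval₂ φ v (planeSection h A) = eval₂ φ (fun i => ∑ j, φ (A i j) * v j) h := by
  change eval₂Hom φ v (bind₁ _ h) = _
  rw [eval₂Hom_bind₁]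
  simp [coe_eval₂Hom]

variable {d : ℕ} {K : Type*} [Field K] [NumberField K]

theorem eval₂_normHypersurface {L : Type*} [Field L] (φ : LaurentQ →+* L)
    (b : Module.Basis (Fin d) ℚ K) (w : Option (Fin d) → L) :
    eval₂ φ w (normHypersurface b) =
      eval₂ (φ.comp HahnSeries.C) (fun i => w (some i)) (normForm b) -
        φ LaurentQ.t * w none ^ d := by
  rw [normHypersurface, eval₂_sub, eval₂_rename, eval₂_mul, eval₂_C, eval₂_pow, eval₂_X,
    eval₂_map]
  rfl

/-- The vector `A v`, carried to Hahn series by `ψ`, solves `N = t z^d` and so vanishes; the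
invertible minor of rows `r` then forces `v = 0`. Only the image of `t` has to be known, as the
other coefficients of the hypersurface are rational. -/
theorem eq_zero_of_eval₂_planeSection_eq_zero (hd : 3 ≤ d) (hK : IsSymmetricNumberField d K)
    (b : Module.Basis (Fin d) ℚ K) {A : Matrix (Option (Fin d)) (Fin 3) LaurentQ}
    {r : Fin 3 → Option (Fin d)} (hA : (A.submatrix r id).det ≠ 0)
    {L : Type*} [Field L] (φ : LaurentQ →+* L) (ψ : L →+* QbarHahn)
    (ht : ψ (φ LaurentQ.t) = HahnSeries.single 1 1) (hψ : ∀ x, IsHalfAb (ψ x))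
    {v : Fin 3 → L} (hv : eval₂ φ v (planeSection (normHypersurface b) A) = 0) : v = 0 := by
  rw [eval₂_planeSection] at hv
  set w : Option (Fin d) → L := fun i => ∑ j, φ (A i j) * v j with hw
  have hψw := congrArg ψ hv
  rw [eval₂_normHypersurface, map_sub, map_mul, ht, map_pow, map_zero, sub_eq_zero] at hψw
  have h1 : ψ (eval₂ (φ.comp HahnSeries.C) (fun i => w (some i)) (normForm b)) =
      ∏ φ : K →ₐ[ℚ] AlgebraicClosure ℚ, ∑ i, HahnSeries.C (φ (b i)) * ψ (w (some i)) := by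
    have h2 : (ψ.comp (φ.comp HahnSeries.C) : ℚ →+* QbarHahn) =
        (HahnSeries.C).comp (algebraMap ℚ (AlgebraicClosure ℚ)) := Subsingleton.elim _ _
    have h3 := congrArg (eval₂ (HahnSeries.C : AlgebraicClosure ℚ →+* QbarHahn)
      (fun i => ψ (w (some i)))) (map_normForm_eq_prod (E := AlgebraicClosure ℚ) b)
    rw [eval₂_map, ← h2] at h3
    rw [← coe_eval₂Hom, ← RingHom.comp_apply, MvPolynomial.comp_eval₂Hom, coe_eval₂Hom]
    refine h3.trans ?_
    rw [← coe_eval₂Hom, map_prod]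
    simp [coe_eval₂Hom]
  rw [h1] at hψw
  obtain ⟨hx, hz⟩ := eq_zero_of_prod_embedding_eq hd hK b (fun i => hψ (w (some i)))
    (hψ (w none)) hψw
  have hw0 : ∀ i, w i = 0 := by
    rintro (_ | i)
    · exact (map_eq_zero ψ).1 hz
    · exact (map_eq_zero ψ).1 (congrFun hx i)
  have hdet : ((A.submatrix r id).map φ).det ≠ 0 := by
    have := (map_ne_zero φ).2 hA
    rwa [RingHom.map_det] at this
  refine Matrix.eq_zero_of_mulVec_eq_zero hdet ?_
  ext i
  exact hw0 (r i)

theorem SmoothPlaneCurve.noAbelianPoints_of_form_eq (hd : 3 ≤ d) (hK : IsSymmetricNumberField d K)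
    (b : Module.Basis (Fin d) ℚ K) {A : Matrix (Option (Fin d)) (Fin 3) LaurentQ}
    {r : Fin 3 → Option (Fin d)} (hA : (A.submatrix r id).det ≠ 0)
    (C : SmoothPlaneCurve LaurentQ d) (hC : C.form = planeSection (normHypersurface b) A) :
    C.NoAbelianPoints := by
  constructor
  · obtain ⟨ψ, ht, hψ⟩ := exists_maximalAbelianExtension_toHahn
    refine Set.eq_empty_of_forall_notMem fun p hp => p.rep_nonzero ?_
    change eval₂ _ p.rep C.form = 0 at hp
    rw [hC] at hp
    exact eq_zero_of_eval₂_planeSection_eq_zero hd hK b hA _ ψ ht hψ hp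
  · refine Set.eq_empty_of_forall_notMem fun p hp => p.rep_nonzero ?_
    change eval₂ _ p.rep C.form = 0 at hp
    rw [hC] at hp
    exact eq_zero_of_eval₂_planeSection_eq_zero hd hK b hA _ RatAb.toHahn
      RatAb.toHahn_toCompletedAb_t RatAb.isHalfAb_toHahn hp

end NoAbelianPoints

/-! ### Nonsingular plane forms are irreducible -/

section Irreducible

/-- Over a domain the lowest and the highest degree are both additive on products. They agree for `f
* g`, and lowest is at most highest for each factor, so they agree for `f`. -/
theorem exists_isHomogeneous_of_mul {σ R : Type*} [CommRing R] [IsDomain R]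
    {f g : MvPolynomial σ R} {n : ℕ} (hfg : (f * g).IsHomogeneous n) (h0 : f * g ≠ 0) :
    ∃ m, f.IsHomogeneous m := by
  have hf : f ≠ 0 := left_ne_zero_of_mul h0
  have hg : g ≠ 0 := right_ne_zero_of_mul h0
  have hord : ∀ p : MvPolynomial σ R, p ≠ 0 →
      (p : MvPowerSeries σ R).order ≤ p.totalDegree := fun p hp => by
    obtain ⟨s, hs⟩ := exists_coeff_ne_zero hp
    refine (MvPowerSeries.order_le (d := s) (by simpa using hs)).trans ?_
    exact_mod_cast le_totalDegree (mem_support_iff.2 hs)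
  have hmul : (n : ℕ∞) ≤ (f : MvPowerSeries σ R).order + (g : MvPowerSeries σ R).order := by
    rw [← MvPowerSeries.order_mul, ← coe_mul]
    refine MvPowerSeries.nat_le_order fun s hs => ?_
    rw [coeff_coe]
    exact hfg.coeff_eq_zero hs.ne
  have hdeg : f.totalDegree + g.totalDegree = n := by
    rw [← totalDegree_mul_of_isDomain hf hg]
    exact hfg.totalDegree h0
  refine ⟨f.totalDegree, fun s hs => ?_⟩
  have h1 : s.degree ≤ f.totalDegree := le_totalDegree (mem_support_iff.2 hs)
  have h2 : (f : MvPowerSeries σ R).order ≤ s.degree :=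
    MvPowerSeries.order_le (by simpa using hs)
  have h3 : (n : ℕ∞) ≤ ((s.degree + g.totalDegree : ℕ) : ℕ∞) := by
    refine hmul.trans ?_
    push_cast
    exact add_le_add h2 (hord g hg)
  have h4 : n ≤ s.degree + g.totalDegree := by exact_mod_cast h3
  have h5 : Finsupp.weight 1 s = s.degree := by
    rw [Finsupp.degree_eq_weight_one]
    rfl
  omega

/-- The kernels of setting the first `j` variables to zero, for `j = 0, …, 3`, form a strict chain
of primes below this ideal. -/
theorem three_le_height_vanishingIdeal_zero {k : Type*} [Field k] :
    3 ≤ (vanishingIdeal k {(0 : Fin 3 → k)} : Ideal (MvPolynomial (Fin 3) k)).height := by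
  let ev : ℕ → MvPolynomial (Fin 3) k →ₐ[k] MvPolynomial (Fin 3) k := fun j =>
    aeval fun i : Fin 3 => if i.val < j then 0 else X i
  let P : ℕ → Ideal (MvPolynomial (Fin 3) k) := fun j => RingHom.ker (ev j)
  have hP : ∀ j, (P j).IsPrime := fun j => RingHom.ker_isPrime _
  have hcomp : ∀ j, (ev (j + 1)).comp (ev j) = ev (j + 1) := by
    intro j
    ext i : 1
    simp only [ev, AlgHom.comp_apply, aeval_X]
    split_ifs with h1 h2 h2
    · simp
    · omega
    · rw [aeval_X, if_pos h2]
    · rw [aeval_X, if_neg h2]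
  have hlt : ∀ j < 3, P j < P (j + 1) := by
    intro j hj
    refine lt_of_le_of_ne (fun f hf => ?_) fun h => ?_
    · change ev (j + 1) f = 0
      rw [← hcomp, AlgHom.comp_apply, show ev j f = 0 from hf, map_zero]
    · have h1 : (X (⟨j, hj⟩ : Fin 3) : MvPolynomial (Fin 3) k) ∈ P (j + 1) := by
        change ev (j + 1) _ = 0
        simp [ev]
      rw [← h] at h1
      have h2 : ev j (X (⟨j, hj⟩ : Fin 3)) = 0 := h1
      simp [ev] at h2
  have hheight : ∀ j : ℕ, j ≤ 3 → (j : ℕ∞) ≤ (P j).height := by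
    intro j
    induction j with
    | zero => simp
    | succ j ih =>
      intro hj
      push_cast
      exact (add_le_add (ih (by omega)) le_rfl).trans
        (Ideal.height_add_one_le_of_lt_of_isPrime (hlt j (by omega)))
  refine (hheight 3 le_rfl).trans (Ideal.height_mono fun f hf => ?_)
  have h1 : ev 3 f = 0 := hf
  have h2 : (aeval (0 : Fin 3 → k)).comp (ev 3) = aeval (0 : Fin 3 → k) := by
    ext i
    simp [ev]
  rw [mem_vanishingIdeal_singleton_iff, ← h2, AlgHom.comp_apply, h1, map_zero]

/-- If the origin were the only common zero, the Nullstellensatz would make its ideal, of height at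
least `3`, minimal over an ideal with two generators, against Krull's height theorem. -/
theorem exists_common_zero {k : Type*} [Field k] [IsAlgClosed k] {g h : MvPolynomial (Fin 3) k}
    (hg : aeval (0 : Fin 3 → k) g = 0) (hh : aeval (0 : Fin 3 → k) h = 0) :
    ∃ v : Fin 3 → k, v ≠ 0 ∧ aeval v g = 0 ∧ aeval v h = 0 := by
  classical
  by_contra! hcon
  let I : Ideal (MvPolynomial (Fin 3) k) := Ideal.span (({g, h} : Finset _) : Set _)
  have hI : zeroLocus k I = {0} := by
    ext v
    rw [zeroLocus_span]
    simp only [Finset.coe_insert, Finset.coe_singleton, Set.mem_insert_iff, Set.mem_singleton_iff,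
      forall_eq_or_imp, forall_eq, Set.mem_ofPred_eq]
    constructor
    · rintro ⟨h1, h2⟩
      by_contra hv
      exact hcon v hv h1 h2
    · rintro rfl
      exact ⟨hg, hh⟩
  have hrad := vanishingIdeal_zeroLocus_eq_radical (K := k) I
  rw [hI] at hrad
  have hmin : (vanishingIdeal k {(0 : Fin 3 → k)} : Ideal (MvPolynomial (Fin 3) k)) ∈
      I.minimalPrimes := by
    refine ⟨⟨inferInstance, hrad ▸ Ideal.le_radical⟩, fun q hq _ => ?_⟩
    rw [hrad]
    exact hq.1.radical_le_iff.2 hq.2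
  have h1 := Ideal.height_le_card_of_mem_minimalPrimes_span_finset hmin
  have h2 := (three_le_height_vanishingIdeal_zero (k := k)).trans h1
  have h3 : ({g, h} : Finset (MvPolynomial (Fin 3) k)).card ≤ 2 := Finset.card_le_two
  have h4 : (3 : ℕ) ≤ ({g, h} : Finset (MvPolynomial (Fin 3) k)).card := by exact_mod_cast h2
  omega

theorem aeval_zero_of_isHomogeneous {σ k : Type*} [Field k] {f : MvPolynomial σ k} {n : ℕ}
    (hf : f.IsHomogeneous n) (hn : n ≠ 0) : aeval (0 : σ → k) f = 0 := by
  rw [aeval_zero, constantCoeff_eq, hf.coeff_eq_zero (by simpa using hn.symm), map_zero]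

/-- Two factors of positive degree are homogeneous and have a common zero in `ℙ²`, where by the
Leibniz rule all partial derivatives of the product vanish. -/
theorem IsNonsingularForm.irreducible {k : Type*} [Field k] {f : MvPolynomial (Fin 3) k} {d : ℕ}
    (hd : d ≠ 0) (hf : f.IsHomogeneous d) (hns : IsNonsingularForm f) :
    Irreducible (map (algebraMap k (AlgebraicClosure k)) f) := by
  set F := map (algebraMap k (AlgebraicClosure k)) f with hF
  have hFd : F.IsHomogeneous d := hf.map _
  have hev : ∀ (v : Fin 3 → AlgebraicClosure k) (p : MvPolynomial (Fin 3) k),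
      aeval v p = aeval v (map (algebraMap k (AlgebraicClosure k)) p) := fun v p => by
    rw [aeval_map_algebraMap]
  have hF0 : F ≠ 0 := fun h0 => by
    refine hns (fun _ => 1) (fun h => one_ne_zero (congrFun h 0)) ⟨?_, fun i => ?_⟩
    · rw [hev, ← hF, h0, map_zero]
    · rw [hev, ← pderiv_map, ← hF, h0, map_zero, map_zero]
  have hunit : ∀ p : MvPolynomial (Fin 3) (AlgebraicClosure k), p ≠ 0 → p.IsHomogeneous 0 →
      IsUnit p := fun p hp h => by
    rw [totalDegree_eq_zero_iff_eq_C.1 ((totalDegree_zero_iff_isHomogeneous _).2 h)] at hp ⊢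
    exact (Ne.isUnit (fun h => hp (by rw [h, C_0]))).map C
  refine ⟨fun hu => ?_, fun g h hgh => ?_⟩
  · have h1 := hu.map (aeval (0 : Fin 3 → AlgebraicClosure k))
    rw [aeval_zero_of_isHomogeneous hFd hd] at h1
    exact not_isUnit_zero h1
  · have hgh0 : g * h ≠ 0 := hgh ▸ hF0
    obtain ⟨m, hm⟩ := exists_isHomogeneous_of_mul (hgh ▸ hFd) hgh0
    obtain ⟨n, hn⟩ := exists_isHomogeneous_of_mul (f := h) (g := g)
      (by rw [mul_comm]; exact hgh ▸ hFd) (by rwa [mul_comm])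
    by_cases hm0 : m = 0
    · exact Or.inl (hunit g (left_ne_zero_of_mul hgh0) (hm0 ▸ hm))
    by_cases hn0 : n = 0
    · exact Or.inr (hunit h (right_ne_zero_of_mul hgh0) (hn0 ▸ hn))
    exfalso
    obtain ⟨v, hv, h1, h2⟩ := exists_common_zero (aeval_zero_of_isHomogeneous hm hm0)
      (aeval_zero_of_isHomogeneous hn hn0)
    refine hns v hv ⟨?_, fun i => ?_⟩
    · rw [hev, ← hF, hgh, map_mul, h1, zero_mul]
    · rw [hev, ← pderiv_map, ← hF, hgh, Derivation.leibniz, map_add, smul_eq_mul, smul_eq_mul,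
        map_mul, map_mul, h1, h2, zero_mul, zero_mul, add_zero]

end Irreducible

/-! ### Linear sections with variable coefficients -/

section LinearSection

/-- The form `h` with the linear forms `∑ j, A i j * X j` substituted for its variables and the
ring homomorphism `ρ` applied to its coefficients. -/
def linearSection {ι R S : Type*} [CommRing R] [CommRing S] (ρ : R →+* S) (A : ι → Fin 3 → S)
    (h : MvPolynomial ι R) : MvPolynomial (Fin 3) S :=
  eval₂ ((C : S →+* MvPolynomial (Fin 3) S).comp ρ) (fun i => ∑ j, C (A i j) * X j) h

theorem linearSection_id {ι k : Type*} [Field k] (A : Matrix ι (Fin 3) k) (h : MvPolynomial ι k) :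
    linearSection (RingHom.id k) A h = planeSection h A := rfl

theorem map_linearSection {ι R S T : Type*} [CommRing R] [CommRing S] [CommRing T] (ρ : R →+* S)
    (θ : S →+* T) (A : ι → Fin 3 → S) (h : MvPolynomial ι R) :
    map θ (linearSection ρ A h) = linearSection (θ.comp ρ) (fun i j => θ (A i j)) h := by
  rw [linearSection, ← coe_eval₂Hom, ← RingHom.comp_apply, MvPolynomial.comp_eval₂Hom,
    coe_eval₂Hom, linearSection]
  congr 1
  · ext x
    simp
  · ext i : 1
    simp

theorem isHomogeneous_linearSection {ι R S : Type*} [CommRing R] [CommRing S] (ρ : R →+* S)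
    (A : ι → Fin 3 → S) {h : MvPolynomial ι R} {d : ℕ} (hh : h.IsHomogeneous d) :
    (linearSection ρ A h).IsHomogeneous d := by
  have := hh.eval₂ ((C : S →+* MvPolynomial (Fin 3) S).comp ρ) (fun i => ∑ j, C (A i j) * X j)
    (n := 1) (fun r => isHomogeneous_C _ _)
    (fun i => IsHomogeneous.sum _ _ _ fun j _ => isHomogeneous_C_mul_X _ _)
  rwa [one_mul] at this

end LinearSection

/-! ### Macaulay's determinant as a criterion for smoothness -/

section Macaulay

/-- The exponents of the monomials of degree `N` in three variables. -/
abbrev Expo (N : ℕ) : Type := {s : Fin 3 →₀ ℕ // s.degree = N}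

instance (N : ℕ) : Finite (Expo N) :=
  Set.Finite.to_subtype (Finsupp.finite_of_degree_le N |>.subset fun s (hs : s.degree = N) => hs.le)

instance (N : ℕ) : Fintype (Expo N) := Fintype.ofFinite _

/-- Pigeonhole: this is the smallest degree in which every monomial is divisible by some `Xᵢ^e`, `e
≥ 1`. -/
theorem exists_le_of_degree_eq {e : ℕ} (s : Expo (3 * (e - 1) + 1)) : ∃ i, e ≤ s.1 i := by
  by_contra! hcon
  have h := s.2
  rw [Finsupp.degree_eq_sum, Fin.sum_univ_three] at h
  have h0 := hcon 0
  have h1 := hcon 1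
  have h2 := hcon 2
  omega

/-- A variable whose exponent in a monomial of degree `3 (e - 1) + 1` is at least `e`. -/
def pivot {e : ℕ} (s : Expo (3 * (e - 1) + 1)) : Fin 3 := (exists_le_of_degree_eq s).choose

theorem le_pivot {e : ℕ} (s : Expo (3 * (e - 1) + 1)) : Finsupp.single (pivot s) e ≤ s.1 := by
  rw [Finsupp.single_le_iff]
  exact (exists_le_of_degree_eq s).choose_spec

/-- The multiple of degree `3 (e - 1) + 1` of a partial derivative of `G`, a form of
degree `e + 1`. -/
def macaulayForm {R : Type*} [CommRing R] (e : ℕ) (G : MvPolynomial (Fin 3) R)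
    (s : Expo (3 * (e - 1) + 1)) : MvPolynomial (Fin 3) R :=
  monomial (s.1 - Finsupp.single (pivot s) e) 1 * pderiv (pivot s) G

/-- Macaulay's matrix of the three partial derivatives of a form of degree `e + 1`. -/
def macaulayMatrix {R : Type*} [CommRing R] (e : ℕ) (G : MvPolynomial (Fin 3) R) :
    Matrix (Expo (3 * (e - 1) + 1)) (Expo (3 * (e - 1) + 1)) R :=
  fun s s' => coeff s'.1 (macaulayForm e G s)

open Classical in
theorem map_det_macaulayMatrix {R S : Type*} [CommRing R] [CommRing S] (θ : R →+* S) (e : ℕ)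
    (G : MvPolynomial (Fin 3) R) :
    θ (macaulayMatrix e G).det = (macaulayMatrix e (map θ G)).det := by
  rw [RingHom.map_det]
  congr 1
  ext s s'
  simp only [RingHom.mapMatrix_apply, Matrix.map_apply, macaulayMatrix, macaulayForm]
  rw [← coeff_map, map_mul, pderiv_map, map_monomial, map_one]

theorem isHomogeneous_macaulayForm {R : Type*} [CommRing R] {e : ℕ} {G : MvPolynomial (Fin 3) R}
    (hG : G.IsHomogeneous (e + 1)) (s : Expo (3 * (e - 1) + 1)) :
    (macaulayForm e G s).IsHomogeneous (3 * (e - 1) + 1) := by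
  have h1 := (isHomogeneous_monomial (d := s.1 - Finsupp.single (pivot s) e) (1 : R) rfl).mul
    (hG.pderiv (i := pivot s))
  have h2 := congrArg Finsupp.degree (tsub_add_cancel_of_le (le_pivot s))
  rw [map_add, s.2, Finsupp.degree_single] at h2
  rwa [Nat.add_sub_cancel, h2] at h1

theorem eval_eq_sum_expo {R : Type*} [CommRing R] {N : ℕ} {p : MvPolynomial (Fin 3) R}
    (hp : p.IsHomogeneous N) (v : Fin 3 → R) :
    eval v p = ∑ s : Expo N, coeff s.1 p * ∏ i, v i ^ s.1 i := by
  classical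
  refine (eval_eq' v p).trans (Eq.trans ?_ (Finset.sum_map Finset.univ
    (Function.Embedding.subtype _) (fun s => coeff s p * ∏ i, v i ^ s i)))
  refine Finset.sum_subset (fun s hs => ?_) fun s _ hs => ?_
  · rw [Finset.mem_map]
    refine ⟨⟨s, ?_⟩, Finset.mem_univ _, rfl⟩
    by_contra h
    exact mem_support_iff.1 hs (hp.coeff_eq_zero h)
  · rw [notMem_support_iff.1 hs, zero_mul]

open Classical in
-- At a common zero `v` of the partial derivatives, the vector of all monomials in `v` of the given
-- degree lies in the kernel of the matrix; its pure powers then give `v = 0`.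
theorem eq_zero_of_det_macaulayMatrix_ne_zero {k E : Type*} [Field k] [Field E] [Algebra k E]
    {e : ℕ} {G : MvPolynomial (Fin 3) k} (hG : G.IsHomogeneous (e + 1))
    (hdet : (macaulayMatrix e G).det ≠ 0) {v : Fin 3 → E} (hv : ∀ i, aeval v (pderiv i G) = 0) :
    v = 0 := by
  have hdet' : (macaulayMatrix e (map (algebraMap k E) G)).det ≠ 0 := by
    rw [← map_det_macaulayMatrix]
    exact (map_ne_zero _).2 hdet
  have key := Matrix.eq_zero_of_mulVec_eq_zero
    (v := fun s : Expo (3 * (e - 1) + 1) => ∏ i, v i ^ s.1 i) hdet' (by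
      ext s
      have h1 : eval v (macaulayForm e (map (algebraMap k E) G) s) = 0 := by
        have h2 := hv (pivot s)
        rw [aeval_def, ← eval_map] at h2
        rw [macaulayForm, map_mul, pderiv_map, h2, mul_zero]
      rw [eval_eq_sum_expo (isHomogeneous_macaulayForm (hG.map _) s)] at h1
      exact h1)
  ext i
  have h1 := congrFun key ⟨Finsupp.single i (3 * (e - 1) + 1), Finsupp.degree_single _ _⟩
  obtain ⟨j, -, hj⟩ := Finset.prod_eq_zero_iff.1 h1
  by_cases hij : i = j
  · subst hij
    exact eq_zero_of_pow_eq_zero hj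
  · simp [hij] at hj

/-- The diagonal form `a₀ X₀ ^ n + a₁ X₁ ^ n + a₂ X₂ ^ n`. -/
def diagonalForm {k : Type*} [Field k] (n : ℕ) (a : Fin 3 → k) : MvPolynomial (Fin 3) k :=
  ∑ i, C (a i) * X i ^ n

open Classical in
-- The partial derivatives are multiples of `Xᵢ^e`, so the row of a monomial is a multiple of that
-- monomial and the matrix is diagonal.
theorem det_macaulayMatrix_diagonalForm_ne_zero {k : Type*} [Field k] [CharZero k] (e : ℕ)
    {a : Fin 3 → k} (ha : ∀ i, a i ≠ 0) : (macaulayMatrix e (diagonalForm (e + 1) a)).det ≠ 0 := by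
  have hpd : ∀ i, pderiv i (diagonalForm (e + 1) a) =
      monomial (Finsupp.single i e) (a i * (e + 1)) := by
    intro i
    rw [diagonalForm, map_sum, Finset.sum_eq_single i]
    · rw [C_mul_X_pow_eq_monomial, pderiv_monomial]
      simp
    · intro j _ hj
      rw [C_mul_X_pow_eq_monomial, pderiv_monomial]
      simp [hj]
    · simp
  have hM : macaulayMatrix e (diagonalForm (e + 1) a) =
      Matrix.diagonal fun s => a (pivot s) * (e + 1) := by
    ext s s'
    rw [macaulayMatrix, macaulayForm, hpd, monomial_mul, tsub_add_cancel_of_le (le_pivot s),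
      coeff_monomial, Matrix.diagonal_apply]
    simp [Subtype.ext_iff]
  rw [hM, Matrix.det_diagonal]
  refine Finset.prod_ne_zero_iff.2 fun s _ => mul_ne_zero (ha _) ?_
  exact_mod_cast e.succ_ne_zero

end Macaulay

/-! ### Smoothness of the general plane section -/

section GeneralSection

variable {d : ℕ} {K : Type*} [Field K] [NumberField K]

theorem isHomogeneous_normForm (b : Module.Basis (Fin d) ℚ K) : (normForm b).IsHomogeneous d := by
  refine IsHomogeneous.of_map (f := algebraMap ℚ (AlgebraicClosure ℚ)) (RingHom.injective _) ?_
  rw [map_normForm_eq_prod]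
  have h := IsHomogeneous.prod Finset.univ
    (fun φ : K →ₐ[ℚ] AlgebraicClosure ℚ =>
      ∑ i, (C (φ (b i)) * X i : MvPolynomial (Fin d) (AlgebraicClosure ℚ))) (fun _ => 1)
    (fun φ _ => IsHomogeneous.sum _ _ _ fun j _ => isHomogeneous_C_mul_X _ _)
  have hcard : Fintype.card (K →ₐ[ℚ] AlgebraicClosure ℚ) = d := by
    rw [AlgHom.card, Module.finrank_eq_card_basis b, Fintype.card_fin]
  simpa [hcard] using h

theorem isHomogeneous_normHypersurface (b : Module.Basis (Fin d) ℚ K) :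
    (normHypersurface b).IsHomogeneous d := by
  refine IsHomogeneous.sub (((isHomogeneous_normForm b).map _).rename_isHomogeneous) ?_
  simpa using (isHomogeneous_C (Option (Fin d)) LaurentQ.t).mul
    (isHomogeneous_X_pow (R := LaurentQ) (none : Option (Fin d)) d)

theorem prod_X_sub_C_mul_X {E : Type*} [Field E] [Infinite E] {n : ℕ} (hn : n ≠ 0) {ζ : E}
    (hζ : IsPrimitiveRoot ζ n) :
    ∏ η ∈ Polynomial.nthRootsFinset n (1 : E), (X 0 - C η * X 1 : MvPolynomial (Fin 3) E) =
      X 0 ^ n - X 1 ^ n := by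
  refine MvPolynomial.funext fun v => ?_
  simp only [map_prod, map_sub, map_mul, eval_X, eval_C, map_pow]
  exact (hζ.pow_sub_pow_eq_prod_sub_mul _ _ (Nat.pos_of_ne_zero hn)).symm

/-- Over an algebraically closed field the hypersurface `N = t Z ^ d` has a Fermat curve as a plane
section. -/
theorem exists_linearSection_normHypersurface_eq_diagonalForm {E : Type*} [Field E] [IsAlgClosed E]
    [CharZero E] (ρ : LaurentQ →+* E) (hd : d ≠ 0) (b : Module.Basis (Fin d) ℚ K) :
    ∃ A : Option (Fin d) → Fin 3 → E,
      linearSection ρ A (normHypersurface b) = diagonalForm d ![1, -1, -ρ LaurentQ.t] := by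
  classical
  let _ : Algebra ℚ E := DivisionRing.toRatAlgebra
  have hcard : Fintype.card (K →ₐ[ℚ] E) = d := by
    rw [AlgHom.card, Module.finrank_eq_card_basis b, Fintype.card_fin]
  have : NeZero d := ⟨hd⟩
  have : NeZero (d : E) := ⟨by simpa using hd⟩
  obtain ⟨ζ, hζ⟩ := HasEnoughRootsOfUnity.exists_primitiveRoot E d
  let e : (K →ₐ[ℚ] E) ≃ Polynomial.nthRootsFinset d (1 : E) := Fintype.equivOfCardEq (by
    rw [hcard, Fintype.card_coe, hζ.card_nthRootsFinset])
  have hcard' : Fintype.card (Fin d) = Fintype.card (K →ₐ[ℚ] E) := by rw [hcard, Fintype.card_fin]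
  let ε := Fintype.equivOfCardEq hcard'
  let M : Matrix (Fin d) (Fin d) E := fun p i => ε p (b i)
  have hM : IsUnit M.det := by
    rw [isUnit_iff_ne_zero]
    intro h0
    obtain ⟨x, hx0, hx⟩ := Matrix.exists_mulVec_eq_zero_iff.2 h0
    refine hx0 (eq_zero_of_forall_sum_embedding_eq_zero b x fun φ => ?_)
    have := congrFun hx (ε.symm φ)
    simpa [M, Matrix.mulVec, dotProduct, mul_comm] using this
  -- The plane is chosen so that the conjugate linear forms restrict to `X₀ - η X₁`, with `η`
  -- running over the `d`-th roots of unity, and `Z` restricts to `X₂`. Inverting the matrix of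
  -- embeddings solves for it.
  let L : Matrix (Fin d) (Fin 3) E := fun p => ![1, -(e (ε p) : E), 0]
  let B : Matrix (Fin d) (Fin 3) E := M⁻¹ * L
  have hB : M * B = L := by rw [← Matrix.mul_assoc, Matrix.mul_nonsing_inv _ hM, Matrix.one_mul]
  let A : Option (Fin d) → Fin 3 → E := fun i => i.elim ![0, 0, 1] B
  refine ⟨A, ?_⟩
  have hnorm : eval₂ ((C : E →+* MvPolynomial (Fin 3) E).comp (ρ.comp HahnSeries.C))
      (fun i => ∑ j, C (B i j) * X j) (normForm b) = X 0 ^ d - X 1 ^ d := by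
    have hprod : ∏ η ∈ Polynomial.nthRootsFinset d (1 : E),
        (X 0 - C η * X 1 : MvPolynomial (Fin 3) E) = ∏ φ, (X 0 - C (e φ : E) * X 1) := by
      rw [← Finset.prod_coe_sort]
      exact (e.prod_comp _).symm
    have h1 : ρ.comp HahnSeries.C = algebraMap ℚ E := Subsingleton.elim _ _
    rw [h1, ← eval₂_map, map_normForm_eq_prod, ← coe_eval₂Hom, map_prod, ← prod_X_sub_C_mul_X hd hζ,
      hprod]
    refine Finset.prod_congr rfl fun φ _ => ?_
    have h2 : ∀ j, ∑ i, φ (b i) * B i j = L (ε.symm φ) j := fun j => by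
      rw [← hB, Matrix.mul_apply]
      simp [M]
    have h3 : ∑ i, C (φ (b i)) * ∑ j, C (B i j) * X j =
        ∑ j : Fin 3, (C (L (ε.symm φ) j) * X j : MvPolynomial (Fin 3) E) := by
      simp only [← h2, map_sum, map_mul, Finset.sum_mul, Finset.mul_sum]
      rw [Finset.sum_comm]
      exact Finset.sum_congr rfl fun j _ => Finset.sum_congr rfl fun i _ => by ring
    simp only [map_sum, map_mul, coe_eval₂Hom, eval₂_C, eval₂_X]
    rw [h3, Fin.sum_univ_three]
    simp [L, sub_eq_add_neg]
  have hsec : linearSection ρ A (normHypersurface b) =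
      eval₂ ((C : E →+* MvPolynomial (Fin 3) E).comp (ρ.comp HahnSeries.C))
        (fun i => ∑ j, C (B i j) * X j) (normForm b) - C (ρ LaurentQ.t) * X 2 ^ d := by
    rw [linearSection, normHypersurface, eval₂_sub, eval₂_rename, eval₂_mul, eval₂_C, eval₂_pow,
      eval₂_X, eval₂_map]
    have h1 : ∑ j, C (A none j) * X j = (X 2 : MvPolynomial (Fin 3) E) := by
      rw [Fin.sum_univ_three]
      simp [show A none = ![0, 0, 1] from rfl]
    rw [h1]
    rfl
  rw [hsec, hnorm, diagonalForm, Fin.sum_univ_three]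
  simp
  ring

open Classical in
-- `P` is the Macaulay determinant of the section by the generic plane. It commutes with
-- specialization: at the Fermat section it is nonzero, so `P ≠ 0`, and where it does not vanish at
-- `A` the section by `A` is nonsingular.
theorem exists_general_nonsingular (hd : 3 ≤ d) (b : Module.Basis (Fin d) ℚ K) :
    ∃ P : MvPolynomial (Option (Fin d) × Fin 3) LaurentQ, P ≠ 0 ∧
      ∀ A : Matrix (Option (Fin d)) (Fin 3) LaurentQ, eval (fun p => A p.1 p.2) P ≠ 0 →
        IsNonsingularForm (planeSection (normHypersurface b) A) := by
  obtain ⟨e, rfl⟩ : ∃ e, d = e + 1 := ⟨d - 1, by omega⟩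
  have : CharZero LaurentQ := algebraRat.charZero _
  have : CharZero (AlgebraicClosure LaurentQ) := algebraRat.charZero _
  let G := linearSection (C : LaurentQ →+* MvPolynomial (Option (Fin (e + 1)) × Fin 3) LaurentQ)
    (fun i j => X (i, j)) (normHypersurface b)
  have ht : LaurentQ.t ≠ 0 := by simp [LaurentQ.t]
  refine ⟨(macaulayMatrix e G).det, fun h0 => ?_, fun A hA v hv hcon => hv ?_⟩
  · obtain ⟨A₀, hA₀⟩ := exists_linearSection_normHypersurface_eq_diagonalForm
      (algebraMap LaurentQ (AlgebraicClosure LaurentQ)) e.succ_ne_zero b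
    have h1 := map_det_macaulayMatrix
      (eval₂Hom (algebraMap LaurentQ (AlgebraicClosure LaurentQ))
        fun p : Option (Fin (e + 1)) × Fin 3 => A₀ p.1 p.2) e G
    rw [h0, map_zero, map_linearSection] at h1
    have h2 : (eval₂Hom (algebraMap LaurentQ (AlgebraicClosure LaurentQ))
        fun p : Option (Fin (e + 1)) × Fin 3 => A₀ p.1 p.2).comp C =
        algebraMap LaurentQ (AlgebraicClosure LaurentQ) := by
      ext x
      simp
    rw [h2] at h1
    simp only [coe_eval₂Hom, eval₂_X] at h1
    rw [hA₀] at h1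
    refine det_macaulayMatrix_diagonalForm_ne_zero e (fun i => ?_) h1.symm
    fin_cases i <;> simp [ht]
  · rw [map_det_macaulayMatrix, map_linearSection] at hA
    have h2 : (eval fun p : Option (Fin (e + 1)) × Fin 3 => A p.1 p.2).comp C =
        RingHom.id LaurentQ := by
      ext x
      simp
    rw [h2] at hA
    simp only [eval_X] at hA
    exact eq_zero_of_det_macaulayMatrix_ne_zero
      (isHomogeneous_linearSection _ _ (isHomogeneous_normHypersurface b)) hA hcon.2

end GeneralSection

/-- The determinant of a fixed `3 × 3` minor of the generic matrix. -/
def genericMinor (k : Type*) [Field k] {ι : Type*} (r : Fin 3 → ι) :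
    MvPolynomial (ι × Fin 3) k :=
  Matrix.det (Matrix.of fun i j : Fin 3 => (X (r i, j) : MvPolynomial (ι × Fin 3) k))

theorem eval_genericMinor {k : Type*} [Field k] {ι : Type*} (r : Fin 3 → ι)
    (A : Matrix ι (Fin 3) k) :
    eval (fun p => A p.1 p.2) (genericMinor k r) = (A.submatrix r id).det := by
  rw [genericMinor, RingHom.map_det]
  congr 1
  ext i j
  simp

theorem genericMinor_ne_zero {k : Type*} [Field k] {ι : Type*} {r : Fin 3 → ι}
    (hr : Function.Injective r) : genericMinor k r ≠ 0 := by
  classical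
  intro h
  let A : Matrix ι (Fin 3) k := Matrix.of fun i j => if i = r j then 1 else 0
  have h1 := eval_genericMinor r A
  have h2 : A.submatrix r id = 1 := by
    ext i j
    simp [A, Matrix.one_apply, hr.eq_iff]
  rw [h, h2] at h1
  simp at h1

theorem Matrix.mulVec_injective_of_det_submatrix_ne_zero {k : Type*} [Field k] {ι : Type*}
    {A : Matrix ι (Fin 3) k} {r : Fin 3 → ι} (hA : (A.submatrix r id).det ≠ 0) :
    Function.Injective A.mulVec := by
  have h := Matrix.mulVec_injective_of_isUnit
    ((Matrix.isUnit_iff_isUnit_det _).2 (isUnit_iff_ne_zero.2 hA))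
  intro v w hvw
  exact h (funext fun i => congrFun hvw (r i))

/-- Multiplying the smoothness condition by one `3 × 3` minor secures rank `3` as well, which also
excludes abelian points. -/
theorem exists_general_smoothPlaneCurve {d : ℕ} (hd : 3 ≤ d) {K : Type*} [Field K] [NumberField K]
    (hK : IsSymmetricNumberField d K) (b : Module.Basis (Fin d) ℚ K) :
    ∃ P : MvPolynomial (Option (Fin d) × Fin 3) LaurentQ, P ≠ 0 ∧
      ∀ A : Matrix (Option (Fin d)) (Fin 3) LaurentQ,
        MvPolynomial.eval (fun p => A p.1 p.2) P ≠ 0 →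
          Function.Injective A.mulVec ∧
          ∃ C : SmoothPlaneCurve LaurentQ d,
            C.form = planeSection (normHypersurface b) A ∧ C.NoAbelianPoints := by
  obtain ⟨P, hP, hns⟩ := exists_general_nonsingular hd b
  have hr : Function.Injective fun i : Fin 3 => some (Fin.castLE hd i) :=
    (Option.some_injective _).comp (Fin.castLE_injective hd)
  refine ⟨P * genericMinor LaurentQ _, mul_ne_zero hP (genericMinor_ne_zero hr), fun A hA => ?_⟩
  rw [map_mul, eval_genericMinor] at hA
  have hmin := right_ne_zero_of_mul hA
  have hsm := hns A (left_ne_zero_of_mul hA)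
  have hhom : (planeSection (normHypersurface b) A).IsHomogeneous d := by
    rw [← linearSection_id]
    exact isHomogeneous_linearSection _ _ (isHomogeneous_normHypersurface b)
  refine ⟨Matrix.mulVec_injective_of_det_submatrix_ne_zero hmin,
    ⟨_, hhom, hsm, hsm.irreducible (by omega) hhom⟩, rfl, ?_⟩
  exact SmoothPlaneCurve.noAbelianPoints_of_form_eq hd hK b hmin _ rfl

theorem IsSymmetricNumberField.exists_smoothPlaneCurve {d : ℕ} (hd : 3 ≤ d) {K : Type*} [Field K]
    [NumberField K] (hK : IsSymmetricNumberField d K) :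
    ∃ C : SmoothPlaneCurve LaurentQ d, C.NoAbelianPoints := by
  obtain ⟨P, hP, h⟩ := exists_general_smoothPlaneCurve hd hK
    (Module.finBasisOfFinrankEq ℚ K hK.1)
  have : Infinite LaurentQ := Infinite.of_injective (algebraMap ℚ LaurentQ)
    (algebraMap ℚ LaurentQ).injective
  obtain ⟨x, hx⟩ : ∃ x, eval x P ≠ 0 := by
    by_contra! h0
    exact hP (MvPolynomial.funext fun x => by simpa using h0 x)
  obtain ⟨-, C, -, hC⟩ := h (fun i j => x (i, j)) hx
  exact ⟨C, hC⟩

/-! ### Number fields with symmetric Galois group, from `X^n - X - 1` -/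

open scoped NumberField in
-- The fixed field of all inertia groups is unramified over `ℚ` at every prime, hence equals `ℚ` by
-- Minkowski's theorem.
theorem NumberField.iSup_inertia_eq_top (L : Type*) [Field L] [NumberField L] [IsGalois ℚ L] :
    ⨆ m : MaximalSpectrum (𝓞 L), m.asIdeal.inertia Gal(L/ℚ) = ⊤ := by
  set I : Subgroup Gal(L/ℚ) := ⨆ m : MaximalSpectrum (𝓞 L), m.asIdeal.inertia Gal(L/ℚ) with hI
  let E : IntermediateField ℚ L := FixedPoints.intermediateField I
  have hG : IsGaloisGroup Gal(L/ℚ) ℤ (𝓞 L) := inferInstance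
  have hG1 : IsGaloisGroup I E L := inferInstanceAs (IsGaloisGroup I (FixedPoints.intermediateField I : IntermediateField ℚ L) L)
  have hG2 : IsGaloisGroup I (𝓞 E) (𝓞 L) := IsGaloisGroup.of_isFractionRing I (𝓞 E) (𝓞 L) E L
  by_contra hne
  have hE : Module.finrank ℚ E ≠ 1 := by
    intro h
    rw [IntermediateField.finrank_eq_one_iff] at h
    apply hne
    rw [← IsGaloisGroup.fixingSubgroup_fixedPoints (K := ℚ) (L := L) (G := Gal(L/ℚ)) I]
    show fixingSubgroup _ (E : Set L) = ⊤
    rw [h, IsGaloisGroup.fixingSubgroup_bot]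
  obtain ⟨P, hP, hunr⟩ := NumberField.exists_not_isUnramifiedAt_int (𝒪 := 𝓞 E) hE
  obtain ⟨Q, hQ, hQP⟩ := Ideal.exists_maximal_ideal_liesOver_of_isIntegral (S := 𝓞 L) P
  have : Finite I := inferInstance
  have h1 : Nat.card (Q.inertia I) = Q.ramificationIdx (𝓞 E) := by
    have : P.IsPrime := hP.isPrime
    rw [Ideal.card_inertia_eq_ramificationIdxIn P Q, Ideal.ramificationIdxIn_eq_ramificationIdx P Q I]
  have h2 : Nat.card (Q.inertia Gal(L/ℚ)) = Q.ramificationIdx ℤ := by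
    rw [Ideal.card_inertia_eq_ramificationIdxIn (Q.under ℤ) Q, Ideal.ramificationIdxIn_eq_ramificationIdx _ Q Gal(L/ℚ)]
  -- The whole inertia group of `Q` lies in `I`, so all ramification of `Q` over `ℤ` occurs above
  -- `E`, and `P` is unramified by multiplicativity in towers.
  have h3 : Nat.card (Q.inertia I) = Nat.card (Q.inertia Gal(L/ℚ)) := by
    exact Nat.card_congr (Subgroup.subgroupOfEquivOfLe
      (le_iSup (fun m : MaximalSpectrum (𝓞 L) => m.asIdeal.inertia Gal(L/ℚ)) ⟨Q, hQ⟩)).toEquiv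
  have h4 := Ideal.ramificationIdx_tower (R := ℤ) P Q
  rw [← h1, h3, h2, right_eq_mul₀ (Ideal.ramificationIdx_pos Q ℤ).ne', Ideal.ramificationIdx_eq_one_iff] at h4
  exact hunr h4

namespace Selmer

/-- The polynomial `X ^ n - X - 1`. -/
def poly (n : ℕ) : Polynomial ℤ := Polynomial.X ^ n - Polynomial.X - 1

theorem map_poly (n : ℕ) {R : Type*} [CommRing R] (φ : ℤ →+* R) :
    (poly n).map φ = Polynomial.X ^ n - Polynomial.X - 1 := by
  simp [poly, Polynomial.map_sub]

theorem monic_poly {n : ℕ} (hn : 2 ≤ n) : (poly n).Monic := by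
  rw [poly, sub_sub]
  refine Polynomial.monic_X_pow_sub ?_
  have h : (Polynomial.X + 1 : Polynomial ℤ).degree = 1 := by
    simpa using Polynomial.degree_X_add_C (1 : ℤ)
  rw [h]
  exact_mod_cast hn

theorem natDegree_poly {n : ℕ} (hn : 2 ≤ n) : (poly n).natDegree = n := by
  rw [poly, sub_sub]
  have h : (Polynomial.X + 1 : Polynomial ℤ).natDegree = 1 := by
    simpa using Polynomial.natDegree_X_add_C (1 : ℤ)
  rw [Polynomial.natDegree_sub_eq_left_of_natDegree_lt] <;> simp [h]
  omega

/-- In any characteristic there is at most one multiple root, and it is double: `a^n = a + 1` and `n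
a^(n-1) = 1` give `(n - 1) a = -n`, where `n - 1 ≠ 0` in `k`, as otherwise `n = 0` and `1 = 0`. A
triple root would moreover give `n (n - 1) a^(n-2) = 0`, hence `n - 1 = 0`. -/
theorem le_ncard_rootSet_add_one {n : ℕ} (hn : 2 ≤ n) {k : Type*} [Field k]
    (hs : ((poly n).map (algebraMap ℤ k)).Splits) :
    n ≤ ((poly n).rootSet k).ncard + 1 := by
  classical
  obtain ⟨m, rfl⟩ : ∃ m, n = m + 2 := ⟨n - 2, by omega⟩
  set g := (poly (m + 2)).map (algebraMap ℤ k) with hg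
  have hg' : g = Polynomial.X ^ (m + 2) - Polynomial.X - 1 := map_poly _ _
  have hg0 : g ≠ 0 := ((monic_poly hn).map _).ne_zero
  have hcard : g.roots.card = m + 2 := by
    rw [← hs.natDegree_eq_card_roots, (monic_poly hn).natDegree_map, natDegree_poly hn]
  have hroot (a : k) (ha : 1 < g.roots.count a) :
      a ^ (m + 2) = a + 1 ∧ ((m : k) + 2) * a ^ (m + 1) = 1 := by
    rw [Polynomial.count_roots, Polynomial.one_lt_rootMultiplicity_iff_isRoot hg0, hg'] at ha
    obtain ⟨h1, h2⟩ := ha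
    simp at h1 h2
    exact ⟨by linear_combination h1, by linear_combination h2⟩
  have huniq (a b : k) (ha : 1 < g.roots.count a) (hb : 1 < g.roots.count b) : a = b := by
    obtain ⟨a1, a2⟩ := hroot a ha
    obtain ⟨b1, b2⟩ := hroot b hb
    have ha' : ((m : k) + 1) * a = -(m + 2) := by linear_combination a * a2 - ((m : k) + 2) * a1
    have hb' : ((m : k) + 1) * b = -(m + 2) := by linear_combination b * b2 - ((m : k) + 2) * b1
    have hm : (m : k) + 1 ≠ 0 := by
      intro h
      rw [h, zero_mul] at ha'
      exact one_ne_zero (α := k) (by linear_combination ha' - h)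
    exact mul_left_cancel₀ hm (ha'.trans hb'.symm)
  have hle (a : k) : g.roots.count a ≤ 2 := by
    by_contra! h
    obtain ⟨a1, a2⟩ := hroot a (by omega)
    rw [Polynomial.count_roots] at h
    have h2 := Polynomial.isRoot_iterate_derivative_of_lt_rootMultiplicity h
    rw [hg'] at h2
    have h3 : ((m : k) + 1 + 1) * ((m + 1) * a ^ m) = 0 := by
      simpa [Function.iterate_succ] using h2
    have h4 : (m : k) + 1 = 0 := by
      linear_combination a * h3 - ((m : k) + 1) * a2
    have ha' : ((m : k) + 1) * a = -(m + 2) := by linear_combination a * a2 - ((m : k) + 2) * a1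
    rw [h4, zero_mul] at ha'
    exact one_ne_zero (α := k) (by linear_combination ha' - h4)
  have hset : ((poly (m + 2)).rootSet k).ncard = g.roots.toFinset.card := by
    rw [Polynomial.rootSet_def, Set.ncard_coe_finset, Polynomial.aroots_def]
  rw [hset, ← hcard, ← Multiset.toFinset_sum_count_eq]
  by_cases h : ∃ a, 1 < g.roots.count a
  · obtain ⟨a, ha⟩ := h
    have hmem : a ∈ g.roots.toFinset := by
      rw [Multiset.mem_toFinset, ← Multiset.count_pos]
      omega
    rw [← Finset.add_sum_erase _ _ hmem, ← Finset.card_erase_add_one hmem]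
    have h1 : ∑ x ∈ g.roots.toFinset.erase a, g.roots.count x ≤
        (g.roots.toFinset.erase a).card • 1 := by
      refine Finset.sum_le_card_nsmul _ _ _ fun x hx => ?_
      by_contra! hx1
      exact (Finset.ne_of_mem_erase hx) (huniq x a hx1 ha)
    have h2 := hle a
    simp only [smul_eq_mul, mul_one] at h1
    omega
  · push Not at h
    have h1 := Finset.sum_le_card_nsmul g.roots.toFinset (fun x => g.roots.count x) 1
      fun x _ => h x
    simp only [smul_eq_mul, mul_one] at h1
    omega

open scoped NumberField in
-- Modulo a prime at most two roots collide, so each inertia group acts on the roots through at most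
-- a transposition. The inertia groups generate, and a transitive group generated by transpositions
-- is the full symmetric group. The hypothesis `hgen` makes the action faithful.
theorem nonempty_gal_mulEquiv {n : ℕ} (hn : 2 ≤ n) (L : Type*) [Field L] [NumberField L]
    [IsGalois ℚ L] {x : L} (hx : x ^ n - x - 1 = 0)
    (hgen : ∀ σ : Gal(L/ℚ), (∀ y : L, y ^ n - y - 1 = 0 → σ y = y) → σ = 1) :
    Nonempty (Gal(L/ℚ) ≃* Equiv.Perm (Fin n)) := by
  classical
  set q : Polynomial ℚ := Polynomial.X ^ n - Polynomial.X - 1 with hq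
  have hirr : Irreducible q := Polynomial.X_pow_sub_X_sub_one_irreducible_rat (by omega)
  have hqmap : (poly n).map (algebraMap ℤ ℚ) = q := map_poly n _
  have hqm : q.Monic := hqmap ▸ (monic_poly hn).map _
  have hmin (y : L) (hy : y ^ n - y - 1 = 0) : minpoly ℚ y = q :=
    (minpoly.eq_of_irreducible_of_monic hirr (by simpa [hq] using hy) hqm).symm
  have hqs : (q.map (algebraMap ℚ L)).Splits := hmin x hx ▸ Normal.splits inferInstance x
  have hLmap : (poly n).map (algebraMap ℤ L) = q.map (algebraMap ℚ L) := by
    rw [← hqmap, Polynomial.map_map]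
    congr 1
    exact Subsingleton.elim _ _
  have hmemL (y : L) : y ∈ (poly n).rootSet L ↔ y ^ n - y - 1 = 0 := by
    rw [Polynomial.mem_rootSet_of_ne (monic_poly hn).ne_zero]
    simp [poly]
  have hmemO (y : 𝓞 L) : y ∈ (poly n).rootSet (𝓞 L) ↔ (y : L) ^ n - y - 1 = 0 := by
    rw [Polynomial.mem_rootSet_of_ne (monic_poly hn).ne_zero,
      ← NumberField.RingOfIntegers.coe_eq_zero_iff]
    simp [poly]
  have hOs : ((poly n).map (algebraMap ℤ (𝓞 L))).Splits := by
    refine Polynomial.Splits.of_splits_map_of_injective (i := algebraMap (𝓞 L) L)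
      NumberField.RingOfIntegers.coe_injective ?_ ?_
    · rw [Polynomial.map_map, ← IsScalarTower.algebraMap_eq, hLmap]
      exact hqs
    · intro a ha
      rw [Polynomial.map_map, ← IsScalarTower.algebraMap_eq] at ha
      have : IsIntegral ℤ a := ⟨poly n, monic_poly hn, by
        simpa [Polynomial.eval_map] using (Polynomial.mem_roots'.1 ha).2⟩
      exact ⟨⟨a, this⟩, rfl⟩
  have hcardL : ((poly n).rootSet L).ncard = n := by
    have h1 : (poly n).rootSet L = q.rootSet L := by
      rw [Polynomial.rootSet_def, Polynomial.rootSet_def, Polynomial.aroots_def, hLmap]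
    rw [h1, ← Nat.card_coe_set_eq, Nat.card_eq_fintype_card,
      Polynomial.card_rootSet_eq_natDegree hirr.separable hqs, ← hqmap,
      (monic_poly hn).natDegree_map, natDegree_poly hn]
  have hcardO : ((poly n).rootSet (𝓞 L)).ncard = n := by
    refine Eq.trans ?_ hcardL
    rw [← Set.ncard_image_of_injective _ (NumberField.RingOfIntegers.coe_injective (K := L))]
    refine congrArg Set.ncard ?_
    exact hOs.image_rootSet_of_map_ne_zero (IsScalarTower.toAlgHom ℤ (𝓞 L) L)
      ((monic_poly hn).map _).ne_zero
  have htrans : MulAction.IsPretransitive Gal(L/ℚ) ((poly n).rootSet (𝓞 L)) := by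
    refine ⟨fun y z => ?_⟩
    have h1 : IsConjRoot ℚ ((z : 𝓞 L) : L) ((y : 𝓞 L) : L) := by
      rw [isConjRoot_def, hmin _ ((hmemO _).1 y.2), hmin _ ((hmemO _).1 z.2)]
    obtain ⟨σ, hσ⟩ := isConjRoot_iff_exists_algEquiv.1 h1
    exact ⟨σ, Subtype.ext (NumberField.RingOfIntegers.coe_injective hσ)⟩
  have hsurj := hOs.surjective_toPermHom_of_iSup_inertia_eq_top (G := Gal(L/ℚ))
    (fun m => by
      let _ := Ideal.Quotient.field m.asIdeal
      rw [hcardO]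
      refine le_ncard_rootSet_add_one hn ?_
      have := hOs.map (Ideal.Quotient.mk m.asIdeal)
      rwa [Polynomial.map_map] at this)
    (NumberField.iSup_inertia_eq_top L)
  have hinj : Function.Injective
      (MulAction.toPermHom Gal(L/ℚ) ((poly n).rootSet (𝓞 L))) := by
    rw [injective_iff_map_eq_one]
    intro σ hσ
    refine hgen σ fun y hy => ?_
    have hint : IsIntegral ℤ y := ⟨poly n, monic_poly hn, by
      simpa [poly, Polynomial.eval₂_sub] using hy⟩
    have h1 := congrArg (fun z : (poly n).rootSet (𝓞 L) => ((z : 𝓞 L) : L))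
      (DFunLike.congr_fun hσ ⟨⟨y, hint⟩, (hmemO _).2 hy⟩)
    exact h1
  have : Nonempty ((poly n).rootSet (𝓞 L) ≃ Fin n) := by
    have := Set.Finite.to_subtype (Polynomial.rootSet_finite (poly n) (𝓞 L))
    exact ⟨Finite.equivFinOfCardEq (by rw [Nat.card_coe_set_eq, hcardO])⟩
  obtain ⟨e⟩ := this
  exact ⟨(MulEquiv.ofBijective _ ⟨hinj, hsurj⟩).trans e.permCongrHom⟩
end Selmer

theorem exists_isSymmetricNumberField {d : ℕ} (hd : 2 ≤ d) :
    ∃ (K : Type) (_ : Field K) (_ : NumberField K), IsSymmetricNumberField d K := by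
  set q : Polynomial ℚ := Polynomial.X ^ d - Polynomial.X - 1 with hq
  have hirr : Irreducible q := Polynomial.X_pow_sub_X_sub_one_irreducible_rat (by omega)
  have hqmap : (Selmer.poly d).map (algebraMap ℤ ℚ) = q := Selmer.map_poly d _
  have hdeg : q.natDegree = d := by
    rw [← hqmap, (Selmer.monic_poly hd).natDegree_map, Selmer.natDegree_poly hd]
  have : Fact (Irreducible q) := ⟨hirr⟩
  let K := AdjoinRoot q
  have hfd : FiniteDimensional ℚ K := (AdjoinRoot.powerBasis hirr.ne_zero).finite
  have hK : NumberField K := { to_charZero := charZero_of_injective_algebraMap (algebraMap ℚ K).injective, to_finiteDimensional := by convert hfd }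
  refine ⟨K, inferInstance, hK, ?_, ?_⟩
  · convert (AdjoinRoot.powerBasis hirr.ne_zero).finrank
    rw [AdjoinRoot.powerBasis_dim, hdeg]
  let N := IntermediateField.normalClosure ℚ K (AlgebraicClosure K)
  have : Algebra.IsAlgebraic ℚ (AlgebraicClosure K) := Algebra.IsAlgebraic.trans ℚ K _
  have hnormal : Normal ℚ N := by
    have : IsAlgClosure ℚ (AlgebraicClosure K) := ⟨inferInstance, inferInstance⟩
    convert normalClosure.normal ℚ K (AlgebraicClosure K)
    exact Subsingleton.elim _ _
  have hNfd : FiniteDimensional ℚ N := by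
    convert normalClosure.is_finiteDimensional ℚ K (AlgebraicClosure K)
  have hN : NumberField N := ⟨⟩
  have hgal : IsGalois ℚ N := ⟨⟩
  have hroot (φ : K →ₐ[ℚ] AlgebraicClosure K) :
      φ (AdjoinRoot.root q) ^ d - φ (AdjoinRoot.root q) - 1 = 0 := by
    have h1 : AdjoinRoot.root q ^ d - AdjoinRoot.root q - 1 = 0 := by
      simpa [hq] using AdjoinRoot.eval₂_root q
    simpa using congrArg φ h1
  have hmem (φ : K →ₐ[ℚ] AlgebraicClosure K) (x : K) : φ x ∈ N :=
    AlgHom.fieldRange_le_normalClosure φ ⟨x, rfl⟩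
  obtain ⟨φ₀⟩ : Nonempty (K →ₐ[ℚ] AlgebraicClosure K) := ⟨IsScalarTower.toAlgHom ℚ K _⟩
  refine Selmer.nonempty_gal_mulEquiv hd N (x := ⟨_, hmem φ₀ (AdjoinRoot.root q)⟩)
    (Subtype.ext (hroot φ₀)) fun σ hσ => ?_
  let τ : N →+* N := (σ : N →+* N)
  -- The fixed field of `σ`, viewed in the algebraic closure. It contains the image of each
  -- embedding, which is generated by a root, hence all of the normal closure.
  let M : IntermediateField ℚ (AlgebraicClosure K) :=
    { Subfield.map N.val.toRingHom (RingHom.eqLocusField τ (RingHom.id N)) with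
      algebraMap_mem' := fun r => ⟨(r : N), map_ratCast τ r, by simp⟩ }
  have hNM : N ≤ M := by
    refine normalClosure_le_iff.2 fun φ => ?_
    rintro _ ⟨x, rfl⟩
    let ψ : K →+* N := φ.toRingHom.codRestrict N (hmem φ)
    have h1 : τ.comp ψ = ψ := by
      refine AdjoinRoot.ringHom_ext (Subsingleton.elim _ _) ?_
      exact hσ _ (Subtype.ext (hroot φ))
    exact ⟨ψ x, RingHom.congr_fun h1 x, rfl⟩
  ext y
  obtain ⟨z, hz, hzy⟩ := hNM y.2
  have : z = y := Subtype.ext hzy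
  subst this
  exact congrArg Subtype.val hz

/-! ### Laurent polynomials in three variables -/

/-- Laurent polynomials in three variables. -/
abbrev Laurent₃ (k : Type*) [Field k] : Type _ := AddMonoidAlgebra k (Fin 3 → ℤ)

namespace Laurent₃

open AddMonoidAlgebra (single)

variable {k : Type*} [Field k]

/-- The Laurent polynomials all of whose exponents lie in `S`. -/
def supportedOn (k : Type*) [Field k] (S : Set (Fin 3 → ℤ)) : Submodule k (Laurent₃ k) where
  carrier := {x | ∀ a, x.coeff a ≠ 0 → a ∈ S}
  zero_mem' := fun a h => absurd rfl h
  add_mem' := fun {x y} hx hy a h => by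
    by_cases h1 : x.coeff a = 0
    · refine hy a fun h2 => h ?_
      rw [AddMonoidAlgebra.coeff_add, Finsupp.add_apply, h1, h2, add_zero]
    · exact hx a h1
  smul_mem' := fun c x hx a h => hx a fun h1 => h (by
    rw [AddMonoidAlgebra.coeff_smul_apply, h1, smul_zero])

theorem supportedOn_mono {S S' : Set (Fin 3 → ℤ)} (h : S ⊆ S') :
    supportedOn k S ≤ supportedOn k S' := fun _ hx a ha => h (hx a ha)

theorem single_mem_supportedOn {S : Set (Fin 3 → ℤ)} {a : Fin 3 → ℤ} (ha : a ∈ S) (c : k) :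
    single a c ∈ supportedOn k S := fun b hb => by
  classical
  rw [AddMonoidAlgebra.coeff_single, Finsupp.single_apply] at hb
  by_cases h : a = b
  · exact h ▸ ha
  · simp [h] at hb

theorem eq_sum (x : Laurent₃ k) : x = ∑ a ∈ x.coeff.support, single a (x.coeff a) :=
  (AddMonoidAlgebra.sum_coeff_single x).symm

theorem mul_mem_supportedOn {S S' S'' : Set (Fin 3 → ℤ)}
    (h : ∀ a ∈ S, ∀ b ∈ S', a + b ∈ S'') {x y : Laurent₃ k} (hx : x ∈ supportedOn k S)
    (hy : y ∈ supportedOn k S') : x * y ∈ supportedOn k S'' := by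
  rw [eq_sum x, eq_sum y, Finset.sum_mul_sum]
  refine Submodule.sum_mem _ fun a ha => Submodule.sum_mem _ fun b hb => ?_
  rw [AddMonoidAlgebra.single_mul_single]
  exact single_mem_supportedOn
    (h a (hx a (Finsupp.mem_support_iff.1 ha)) b (hy b (Finsupp.mem_support_iff.1 hb))) _

/-- The part of a Laurent polynomial with exponents in `S`. -/
def part (S : Set (Fin 3 → ℤ)) (x : Laurent₃ k) : Laurent₃ k :=
  open Classical in AddMonoidAlgebra.ofCoeff (x.coeff.filter (· ∈ S))

open Classical in
theorem coeff_part (S : Set (Fin 3 → ℤ)) (x : Laurent₃ k) (a : Fin 3 → ℤ) :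
    (part S x).coeff a = if a ∈ S then x.coeff a else 0 := by
  simp [part, Finsupp.filter_apply]

theorem coeff_eq_zero {S : Set (Fin 3 → ℤ)} {x : Laurent₃ k} (hx : x ∈ supportedOn k S)
    {a : Fin 3 → ℤ} (ha : a ∉ S) : x.coeff a = 0 := by
  by_contra h
  exact ha (hx a h)

/-- The exponents of total degree `N` that are nonnegative outside `T`. -/
def degreeSet (T : Finset (Fin 3)) (N : ℤ) : Set (Fin 3 → ℤ) :=
  {a | a 0 + a 1 + a 2 = N ∧ ∀ i, i ∉ T → 0 ≤ a i}

/-- The exponent of `∏ i ∈ T, X i`. -/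
def indicator (T : Finset (Fin 3)) : Fin 3 → ℤ := fun i => if i ∈ T then 1 else 0

theorem sum_indicator : ∀ T : Finset (Fin 3),
    indicator T 0 + indicator T 1 + indicator T 2 = T.card := by
  unfold indicator
  decide

/-- The inclusion of polynomials into Laurent polynomials. -/
def ofPoly : MvPolynomial (Fin 3) k →ₐ[k] Laurent₃ k := aeval fun i => single (Pi.single i 1) 1

theorem ofPoly_X (i : Fin 3) :
    ofPoly (X i : MvPolynomial (Fin 3) k) = single (Pi.single i 1) 1 := aeval_X _ _

theorem ofPoly_monomial (s : Fin 3 →₀ ℕ) (c : k) :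
    ofPoly (monomial s c) = single (fun i => (s i : ℤ)) c := by
  rw [ofPoly, aeval_monomial, Finsupp.prod_fintype _ _ (by simp)]
  simp only [AddMonoidAlgebra.single_pow, one_pow, Fin.prod_univ_three,
    AddMonoidAlgebra.single_mul_single, mul_one]
  rw [Algebra.algebraMap_eq_smul_one, smul_mul_assoc, one_mul, AddMonoidAlgebra.smul_single,
    smul_eq_mul, mul_one]
  congr 1
  funext i
  fin_cases i <;> simp

theorem ofPoly_eq_sum (p : MvPolynomial (Fin 3) k) :
    ofPoly p = ∑ s ∈ p.support, single (fun i => (s i : ℤ)) (p.coeff s) := by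
  conv_lhs => rw [p.as_sum, map_sum]
  exact Finset.sum_congr rfl fun s _ => ofPoly_monomial s _

theorem coeff_ofPoly (p : MvPolynomial (Fin 3) k) (s : Fin 3 →₀ ℕ) :
    (ofPoly p).coeff (fun i => (s i : ℤ)) = p.coeff s := by
  classical
  rw [ofPoly_eq_sum, AddMonoidAlgebra.coeff_sum, Finsupp.finsetSum_apply]
  have h : ∀ t : Fin 3 →₀ ℕ, ((fun i => (t i : ℤ)) = fun i => (s i : ℤ)) ↔ t = s := fun t => by
    simp [funext_iff, DFunLike.ext_iff]
  simp only [AddMonoidAlgebra.coeff_single, Finsupp.single_apply, h, Finset.sum_ite_eq']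
  by_cases hs : coeff s p = 0 <;> simp [hs]

theorem ofPoly_injective : Function.Injective (ofPoly (k := k)) := fun p q h => by
  ext s
  rw [← coeff_ofPoly, h, coeff_ofPoly]

theorem ofPoly_prod_X_pow (T : Finset (Fin 3)) (n : ℕ) :
    ofPoly ((∏ i ∈ T, X i : MvPolynomial (Fin 3) k) ^ n) = single ((n : ℤ) • indicator T) 1 := by
  rw [map_pow, map_prod]
  have h : ∏ i ∈ T, ofPoly (X i : MvPolynomial (Fin 3) k) = single (indicator T) 1 := by
    induction T using Finset.induction_on with
    | empty => rfl
    | insert i T hi ih =>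
      rw [Finset.prod_insert hi, ih, ofPoly_X, AddMonoidAlgebra.single_mul_single, one_mul]
      congr 1
      funext j
      by_cases hj : j = i
      · subst hj
        simp [indicator, hi]
      · simp [indicator, hj]
  rw [h, AddMonoidAlgebra.single_pow, one_pow, natCast_zsmul]

theorem ofPoly_mem {p : MvPolynomial (Fin 3) k} {N : ℕ} (hp : p.IsHomogeneous N) :
    ofPoly p ∈ supportedOn k (degreeSet ∅ N) := by
  rw [ofPoly_eq_sum]
  refine Submodule.sum_mem _ fun s hs =>
    single_mem_supportedOn (S := degreeSet ∅ N) ⟨?_, fun i _ => by positivity⟩ _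
  have h := hp (mem_support_iff.1 hs)
  rw [Finsupp.weight_apply, Finsupp.sum_fintype _ _ (by simp), Fin.sum_univ_three] at h
  simp only [Pi.one_apply, smul_eq_mul, mul_one] at h
  exact_mod_cast h

theorem exists_ofPoly_eq {x : Laurent₃ k} {N : ℕ} (hx : x ∈ supportedOn k (degreeSet ∅ N)) :
    ∃ p : MvPolynomial (Fin 3) k, p.IsHomogeneous N ∧ ofPoly p = x := by
  refine ⟨∑ a ∈ x.coeff.support,
    monomial (Finsupp.equivFunOnFinite.symm fun i => (a i).toNat) (x.coeff a), ?_, ?_⟩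
  · refine IsHomogeneous.sum _ _ _ fun a ha => isHomogeneous_monomial _ ?_
    obtain ⟨h1, h2⟩ := hx a (Finsupp.mem_support_iff.1 ha)
    have h0 := h2 0 (by simp)
    have h1' := h2 1 (by simp)
    have h2' := h2 2 (by simp)
    rw [Finsupp.degree_eq_sum, Fin.sum_univ_three]
    simp only [Finsupp.equivFunOnFinite_symm_apply_apply]
    omega
  · conv_rhs => rw [eq_sum x]
    rw [map_sum]
    refine Finset.sum_congr rfl fun a ha => ?_
    rw [ofPoly_monomial]
    congr 1
    funext i
    obtain ⟨-, h2⟩ := hx a (Finsupp.mem_support_iff.1 ha)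
    simp [h2 i (by simp)]

/-- Clearing denominators identifies these Laurent polynomials with the functions on the open set of
`ℙ²` where the coordinates in `T` are nonzero. -/
theorem exists_ofPoly_eq_mul {T : Finset (Fin 3)} {x : Laurent₃ k}
    (hx : x ∈ supportedOn k (degreeSet T 0)) :
    ∃ (n : ℕ) (p : MvPolynomial (Fin 3) k), p.IsHomogeneous (n * T.card) ∧
      ofPoly p = x * single ((n : ℤ) • indicator T) 1 := by
  -- A crude bound for the absolute values of all exponents that occur.
  let n : ℕ := ∑ a ∈ x.coeff.support, ∑ i, (a i).natAbs
  have hn : x ∈ supportedOn k {a | a ∈ degreeSet T 0 ∧ ∀ i, -(n : ℤ) ≤ a i} := fun a ha => by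
    refine ⟨hx a ha, fun i => ?_⟩
    have h1 : ∑ i, (a i).natAbs ≤ n := Finset.single_le_sum
      (f := fun a : Fin 3 → ℤ => ∑ i, (a i).natAbs) (fun _ _ => Nat.zero_le _)
      (Finsupp.mem_support_iff.2 ha)
    have h2 : (a i).natAbs ≤ ∑ i, (a i).natAbs := Finset.single_le_sum
      (f := fun i => (a i).natAbs) (fun _ _ => Nat.zero_le _) (Finset.mem_univ i)
    omega
  have hmul : x * single ((n : ℤ) • indicator T) 1 ∈
      supportedOn k (degreeSet ∅ ((n * T.card : ℕ) : ℤ)) := by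
    refine mul_mem_supportedOn (S' := {(n : ℤ) • indicator T}) ?_ hn
      (single_mem_supportedOn (Set.mem_singleton _) 1)
    rintro a ⟨⟨ha, ha'⟩, han⟩ _ rfl
    refine ⟨?_, fun i _ => ?_⟩
    · have := sum_indicator T
      simp only [Pi.add_apply, Pi.smul_apply, smul_eq_mul]
      push_cast
      linear_combination ha + (n : ℤ) * this
    · by_cases hi : i ∈ T
      · have := han i
        simp [indicator, hi]
        omega
      · simpa [indicator, hi] using ha' i hi
  obtain ⟨p, hp, hpx⟩ := exists_ofPoly_eq hmul
  exact ⟨n, p, hp, hpx⟩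

theorem ofPoly_mul_single_mem {T : Finset (Fin 3)} {p : MvPolynomial (Fin 3) k} {N n : ℕ} {M : ℤ}
    (hp : p.IsHomogeneous N) (hM : M = N - n * T.card) :
    ofPoly p * single (-((n : ℤ) • indicator T)) 1 ∈ supportedOn k (degreeSet T M) := by
  refine mul_mem_supportedOn (S' := {-((n : ℤ) • indicator T)}) ?_ (ofPoly_mem hp)
    (single_mem_supportedOn (Set.mem_singleton _) 1)
  rintro a ⟨ha, ha'⟩ _ rfl
  refine ⟨?_, fun i hi => ?_⟩
  · have := sum_indicator T
    simp only [Pi.add_apply, Pi.neg_apply, Pi.smul_apply, smul_eq_mul]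
    linear_combination ha - (n : ℤ) * this - hM
  · simpa [indicator, hi] using ha' i (by simp)

end Laurent₃

/-! ### Sections of the structure sheaf as Laurent polynomials -/

namespace PlaneCech

open AddMonoidAlgebra (single)
open Laurent₃

variable {k : Type*} [Field k]

theorem toLoc_apply (f p : MvPolynomial (Fin 3) k) (T : Finset (Fin 3)) :
    toLoc f T p = algebraMap (CoordRing f) (Loc f T) (Ideal.Quotient.mk _ p) := rfl

theorem restrict_algebraMap (f : MvPolynomial (Fin 3) k) {T T' : Finset (Fin 3)} (h : T ⊆ T')
    (c : CoordRing f) :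
    restrict f h (algebraMap (CoordRing f) (Loc f T) c) = algebraMap (CoordRing f) (Loc f T') c :=
  IsLocalization.Away.lift_eq (S := Loc f T) (mon f T) (isUnit_of_dvd_unit
    (map_dvd _ (map_dvd (Ideal.Quotient.mk _) (Finset.prod_dvd_prod_of_subset _ _ _ h)))
    (IsLocalization.Away.algebraMap_isUnit (S := Loc f T') (mon f T'))) c

theorem restrict_toLoc (f p : MvPolynomial (Fin 3) k) {T T' : Finset (Fin 3)} (h : T ⊆ T') :
    restrict f h (toLoc f T p) = toLoc f T' p := restrict_algebraMap f h _

theorem restrict_restrict (f : MvPolynomial (Fin 3) k) {T T' T'' : Finset (Fin 3)} (h : T ⊆ T')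
    (h' : T' ⊆ T'') (z : Loc f T) :
    restrict f h' (restrict f h z) = restrict f (h.trans h') z := by
  have h1 : ((restrict f h').toRingHom.comp (restrict f h).toRingHom) =
      (restrict f (h.trans h')).toRingHom := by
    refine IsLocalization.ringHom_ext (Submonoid.powers (mon f T)) (RingHom.ext fun c => ?_)
    exact (congrArg _ (restrict_algebraMap f h c)).trans
      ((restrict_algebraMap f h' c).trans (restrict_algebraMap f (h.trans h') c).symm)
  exact RingHom.congr_fun h1 z

theorem isUnit_toLoc_prod (f : MvPolynomial (Fin 3) k) (T : Finset (Fin 3)) :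
    IsUnit (toLoc f T (∏ i ∈ T, X i)) :=
  IsLocalization.Away.algebraMap_isUnit (S := Loc f T) (mon f T)

theorem isUnit_toLoc_X (f : MvPolynomial (Fin 3) k) {T : Finset (Fin 3)} {i : Fin 3} (hi : i ∈ T) :
    IsUnit (toLoc f T (X i)) :=
  isUnit_of_dvd_unit (map_dvd _ (Finset.dvd_prod_of_mem _ hi)) (isUnit_toLoc_prod f T)

/-- The coordinate `X i` as a unit on the open set where all coordinates are nonzero. -/
def unitX (f : MvPolynomial (Fin 3) k) (i : Fin 3) : (Loc f {0, 1, 2})ˣ :=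
  (isUnit_toLoc_X f (i := i) (by fin_cases i <;> simp)).unit

theorem val_unitX (f : MvPolynomial (Fin 3) k) (i : Fin 3) :
    (unitX f i : Loc f {0, 1, 2}) = toLoc f {0, 1, 2} (X i) := rfl

/-- The restriction of a Laurent polynomial to the open part of the curve where all coordinates are
nonzero. -/
def ofLaurent (f : MvPolynomial (Fin 3) k) : Laurent₃ k →ₐ[k] Loc f {0, 1, 2} :=
  AddMonoidAlgebra.lift k _ _
    { toFun := fun a => ((∏ i, unitX f i ^ (a.toAdd i) : (Loc f {0, 1, 2})ˣ) : Loc f {0, 1, 2})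
      map_one' := by simp
      map_mul' := fun a b => by
        rw [← Units.val_mul, ← Finset.prod_mul_distrib]
        simp only [toAdd_mul, Pi.add_apply, zpow_add] }

theorem ofLaurent_single (f : MvPolynomial (Fin 3) k) (a : Fin 3 → ℤ) :
    ofLaurent f (single a 1) = ((∏ i, unitX f i ^ a i : (Loc f {0, 1, 2})ˣ) : Loc f {0, 1, 2}) := by
  rw [ofLaurent, AddMonoidAlgebra.lift_single, one_smul]
  rfl

theorem ofLaurent_ofPoly (f p : MvPolynomial (Fin 3) k) :
    ofLaurent f (ofPoly p) = toLoc f {0, 1, 2} p := by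
  have h : (ofLaurent f).comp ofPoly = toLoc f {0, 1, 2} := by
    refine algHom_ext fun i => ?_
    rw [AlgHom.comp_apply, ofPoly_X, ofLaurent_single, ← val_unitX]
    congr 1
    rw [Finset.prod_eq_single i (fun j _ hj => by simp [hj]) (by simp)]
    simp
  exact DFunLike.congr_fun h p

theorem toLoc_self (f : MvPolynomial (Fin 3) k) (T : Finset (Fin 3)) : toLoc f T f = 0 := by
  rw [toLoc_apply, Ideal.Quotient.eq_zero_iff_mem.2 (Ideal.mem_span_singleton_self f), map_zero]

theorem ofLaurent_self_mul (f : MvPolynomial (Fin 3) k) (x : Laurent₃ k) :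
    ofLaurent f (ofPoly f * x) = 0 := by
  rw [map_mul, ofLaurent_ofPoly, toLoc_self, zero_mul]

theorem single_mul_single_neg (a : Fin 3 → ℤ) :
    (single a 1 * single (-a) 1 : Laurent₃ k) = 1 := by
  rw [AddMonoidAlgebra.single_mul_single, add_neg_cancel, one_mul]
  rfl

/-- A section is a fraction with monomial denominator, and the same fraction read as a Laurent
polynomial lifts it to `ℙ²`. -/
theorem exists_ofLaurent_eq_restrict (f : MvPolynomial (Fin 3) k) {T : Finset (Fin 3)}
    (h : T ⊆ {0, 1, 2}) {z : Loc f T} (hz : z ∈ sections f T) :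
    ∃ x ∈ supportedOn k (degreeSet T 0), ofLaurent f x = restrict f h z := by
  obtain ⟨n, a, ha, hza⟩ := hz
  refine ⟨_, ofPoly_mul_single_mem (T := T) (n := n) (M := 0) ha (by push_cast; ring), ?_⟩
  have h1 := congrArg (restrict f h) hza
  rw [map_mul, map_pow, restrict_toLoc, restrict_toLoc, ← ofLaurent_ofPoly, ← ofLaurent_ofPoly,
    ← map_pow, ← map_pow, ofPoly_prod_X_pow] at h1
  rw [map_mul, ← h1, mul_assoc, ← map_mul, single_mul_single_neg, map_one, mul_one]

theorem exists_section_restrict_eq (f : MvPolynomial (Fin 3) k) {T : Finset (Fin 3)}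
    (h : T ⊆ {0, 1, 2}) {x : Laurent₃ k} (hx : x ∈ supportedOn k (degreeSet T 0)) :
    ∃ z ∈ sections f T, restrict f h z = ofLaurent f x := by
  obtain ⟨n, p, hp, hpx⟩ := exists_ofPoly_eq_mul hx
  obtain ⟨u, hu⟩ := (isUnit_toLoc_prod f T).pow n
  have hz : toLoc f T p * (u⁻¹ : (Loc f T)ˣ) * toLoc f T (∏ i ∈ T, X i) ^ n = toLoc f T p := by
    rw [← hu, mul_assoc, Units.inv_mul, mul_one]
  refine ⟨toLoc f T p * (u⁻¹ : (Loc f T)ˣ), ⟨n, p, hp, hz⟩, ?_⟩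
  have h1 := congrArg (restrict f h) hz
  rw [map_mul, map_pow, restrict_toLoc, restrict_toLoc, ← ofLaurent_ofPoly, ← ofLaurent_ofPoly,
    ← map_pow, ← map_pow, ofPoly_prod_X_pow, hpx] at h1
  have h2 : IsUnit (ofLaurent f (single ((n : ℤ) • indicator T) 1)) :=
    IsUnit.map _ (IsUnit.of_mul_eq_one _ (single_mul_single_neg _))
  exact h2.mul_right_cancel (h1.trans (map_mul _ _ _))

section Prime

variable {f : MvPolynomial (Fin 3) k} (hf : Prime f) (hX : ∀ i, ¬ f ∣ X i)

include hf in
theorem isDomain_coordRing : IsDomain (CoordRing f) :=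
  have := (Ideal.span_singleton_prime hf.ne_zero).2 hf
  Ideal.Quotient.isDomain _

include hf hX in
theorem mon_ne_zero (T : Finset (Fin 3)) : mon f T ≠ 0 := by
  rw [mon, Ne, Ideal.Quotient.eq_zero_iff_mem, Ideal.mem_span_singleton,
    hf.dvd_finsetProd_iff]
  rintro ⟨i, -, hi⟩
  exact hX i hi

include hf hX in
theorem algebraMap_loc_injective (T : Finset (Fin 3)) :
    Function.Injective (algebraMap (CoordRing f) (Loc f T)) := by
  have := isDomain_coordRing hf
  exact IsLocalization.injective _ (powers_le_nonZeroDivisors_of_noZeroDivisors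
    (mon_ne_zero hf hX T))

include hf hX in
-- The coordinate ring is a domain in which no coordinate vanishes, so sections can be compared on
-- the open set where all coordinates are nonzero.
theorem restrict_injective {T T' : Finset (Fin 3)} (h : T ⊆ T') :
    Function.Injective (restrict f h) := by
  rw [injective_iff_map_eq_zero]
  intro z hz
  obtain ⟨⟨c, s⟩, hc⟩ := IsLocalization.surj (Submonoid.powers (mon f T)) z
  have h1 := congrArg (restrict f h) hc
  rw [map_mul, hz, zero_mul, restrict_algebraMap] at h1
  have h2 : c = 0 := algebraMap_loc_injective hf hX T' (by rw [← h1, map_zero])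
  have h3 := IsLocalization.map_units (Loc f T) s
  simp only [h2, map_zero] at hc
  exact h3.mul_left_eq_zero.1 hc

include hf hX in
-- Exactness of `0 → 𝒪(-d) → 𝒪 → 𝒪_C` on an open set: after clearing denominators `f` divides the
-- numerator, and the quotient is homogeneous.
theorem exists_eq_mul_of_ofLaurent_eq_zero {d : ℕ} (hd : f.IsHomogeneous d) {T : Finset (Fin 3)}
    {x : Laurent₃ k} (hx : x ∈ supportedOn k (degreeSet T 0)) (h0 : ofLaurent f x = 0) :
    ∃ y ∈ supportedOn k (degreeSet T (-d)), x = ofPoly f * y := by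
  by_cases hx0 : x = 0
  · exact ⟨0, zero_mem _, by rw [hx0, mul_zero]⟩
  obtain ⟨n, p, hp, hpx⟩ := exists_ofPoly_eq_mul hx
  have hxp : x = ofPoly p * single (-((n : ℤ) • indicator T)) 1 := by
    rw [hpx, mul_assoc, single_mul_single_neg, mul_one]
  have hp0 : p ≠ 0 := by
    rintro rfl
    exact hx0 (by rw [hxp, map_zero, zero_mul])
  have h1 : toLoc f {0, 1, 2} p = 0 := by
    rw [← ofLaurent_ofPoly, hpx, map_mul, h0, zero_mul]
  have h2 : f ∣ p := by
    rw [← Ideal.mem_span_singleton, ← Ideal.Quotient.eq_zero_iff_mem]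
    exact algebraMap_loc_injective hf hX {0, 1, 2} (by rw [map_zero]; exact h1)
  obtain ⟨q, rfl⟩ := h2
  obtain ⟨m, hm⟩ := exists_isHomogeneous_of_mul (f := q) (g := f) (mul_comm f q ▸ hp)
    (mul_comm f q ▸ hp0)
  have hdeg := (hd.mul hm).inj_right hp hp0
  refine ⟨_, ofPoly_mul_single_mem (T := T) (n := n) hm ?_, ?_⟩
  · have : (d : ℤ) + m = n * T.card := by exact_mod_cast hdeg
    linear_combination -this
  · rw [hxp, map_mul, mul_assoc]

end Prime
end PlaneCech

/-! ### Čech cohomology of twists of the structure sheaf on `ℙ²` -/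

namespace Laurent₃

variable {k : Type*} [Field k]

theorem degreeSet_mono {T T' : Finset (Fin 3)} (h : T ⊆ T') {N : ℤ} :
    supportedOn k (degreeSet T N) ≤ supportedOn k (degreeSet T' N) :=
  supportedOn_mono fun _ ha => ⟨ha.1, fun i hi => ha.2 i fun h' => hi (h h')⟩

/-- The first Čech cohomology of the structure sheaf of `ℙ²` vanishes. -/
theorem exists_coboundary {N : ℤ} {u₀₁ u₀₂ u₁₂ : Laurent₃ k}
    (h₀₁ : u₀₁ ∈ supportedOn k (degreeSet {0, 1} N))
    (h₀₂ : u₀₂ ∈ supportedOn k (degreeSet {0, 2} N))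
    (h₁₂ : u₁₂ ∈ supportedOn k (degreeSet {1, 2} N)) (h : u₁₂ - u₀₂ + u₀₁ = 0) :
    ∃ v₀ ∈ supportedOn k (degreeSet {0} N), ∃ v₁ ∈ supportedOn k (degreeSet {1} N),
      ∃ v₂ ∈ supportedOn k (degreeSet {2} N),
        u₀₁ = v₁ - v₀ ∧ u₀₂ = v₂ - v₀ ∧ u₁₂ = v₂ - v₁ := by
  classical
  have hc (a) : u₁₂.coeff a - u₀₂.coeff a + u₀₁.coeff a = 0 :=
    congrArg (fun x : Laurent₃ k => x.coeff a) h
  have h0 (a : Fin 3 → ℤ) (ha : a 0 < 0) : u₁₂.coeff a = 0 :=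
    coeff_eq_zero h₁₂ fun h => by
      have := h.2 0 (by decide)
      omega
  -- Where the exponent of `X₀` is negative, `u₁₂` vanishes and `u₀₁ = u₀₂`, so that part goes to
  -- `v₀`; the remaining parts of `u₀₁` and `u₀₂` are regular in `X₀` and serve as `v₁` and `v₂`.
  refine ⟨-part {a | a 0 < 0} u₀₁, fun a ha => ?_, part {a | 0 ≤ a 0} u₀₁, fun a ha => ?_,
    part {a | 0 ≤ a 0} u₀₂, fun a ha => ?_, ?_, ?_, ?_⟩
  · rw [AddMonoidAlgebra.coeff_neg, Finsupp.neg_apply, coeff_part, neg_ne_zero] at ha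
    split_ifs at ha with h1
    · have h2 : u₀₂.coeff a ≠ 0 := by
        rwa [← sub_eq_zero.1 (by linear_combination hc a - h0 a h1 :
          u₀₁.coeff a - u₀₂.coeff a = 0)]
      refine ⟨(h₀₁ a ha).1, fun i hi => ?_⟩
      fin_cases i
      · simp at hi
      · exact (h₀₂ a h2).2 1 (by decide)
      · exact (h₀₁ a ha).2 2 (by decide)
    · exact absurd rfl ha
  · rw [coeff_part] at ha
    split_ifs at ha with h1
    · refine ⟨(h₀₁ a ha).1, fun i hi => ?_⟩
      fin_cases i
      · exact h1
      · simp at hi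
      · exact (h₀₁ a ha).2 2 (by decide)
    · exact absurd rfl ha
  · rw [coeff_part] at ha
    split_ifs at ha with h1
    · refine ⟨(h₀₂ a ha).1, fun i hi => ?_⟩
      fin_cases i
      · exact h1
      · exact (h₀₂ a ha).2 1 (by decide)
      · simp at hi
    · exact absurd rfl ha
  all_goals
    ext a
    simp only [AddMonoidAlgebra.coeff_sub, AddMonoidAlgebra.coeff_neg, Finsupp.sub_apply,
      Finsupp.neg_apply, coeff_part, Set.mem_ofPred_eq]
    rcases lt_or_ge (a 0) 0 with h1 | h1
    · simp only [h1, not_le.2 h1, if_true, if_false]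
      first
        | ring1
        | linear_combination h0 a h1
        | linear_combination h0 a h1 - hc a
    · simp only [h1, not_lt.2 h1, if_true, if_false]
      first
        | ring1
        | linear_combination hc a

/-- Only monomials with three negative exponents survive in `H²`. Any other monomial is sorted by
the first coordinate whose exponent is nonnegative. -/
theorem exists_eq_alternating_sum {N : ℤ} {w : Laurent₃ k}
    (hw : w ∈ supportedOn k (degreeSet {0, 1, 2} N))
    (h : ∀ a : Fin 3 → ℤ, a 0 < 0 → a 1 < 0 → a 2 < 0 → w.coeff a = 0) :
    ∃ q₀₁ ∈ supportedOn k (degreeSet {0, 1} N), ∃ q₀₂ ∈ supportedOn k (degreeSet {0, 2} N),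
      ∃ q₁₂ ∈ supportedOn k (degreeSet {1, 2} N), w = q₁₂ - q₀₂ + q₀₁ := by
  classical
  refine ⟨part {a | a 0 < 0 ∧ a 1 < 0} w, fun a ha => ?_,
    -part {a | a 0 < 0 ∧ 0 ≤ a 1} w, fun a ha => ?_, part {a | 0 ≤ a 0} w, fun a ha => ?_, ?_⟩
  · rw [coeff_part] at ha
    split_ifs at ha with h1
    · refine ⟨(hw a ha).1, fun i hi => ?_⟩
      fin_cases i
      · simp at hi
      · simp at hi
      · by_contra! h2
        exact ha (h a h1.1 h1.2 h2)
    · exact absurd rfl ha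
  · rw [AddMonoidAlgebra.coeff_neg, Finsupp.neg_apply, coeff_part, neg_ne_zero] at ha
    split_ifs at ha with h1
    · refine ⟨(hw a ha).1, fun i hi => ?_⟩
      fin_cases i
      · simp at hi
      · exact h1.2
      · simp at hi
    · exact absurd rfl ha
  · rw [coeff_part] at ha
    split_ifs at ha with h1
    · refine ⟨(hw a ha).1, fun i hi => ?_⟩
      fin_cases i
      · exact h1
      · simp at hi
      · simp at hi
    · exact absurd rfl ha
  · ext a
    simp only [AddMonoidAlgebra.coeff_add, AddMonoidAlgebra.coeff_sub, AddMonoidAlgebra.coeff_neg,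
      Finsupp.add_apply, Finsupp.sub_apply, Finsupp.neg_apply, coeff_part, Set.mem_ofPred_eq]
    rcases lt_or_ge (a 0) 0 with h1 | h1 <;> rcases lt_or_ge (a 1) 0 with h2 | h2 <;>
      simp [h1, h2, not_le.2, not_lt.2]

/-- The exponents of total degree `-4` all of whose entries are negative. -/
def gap (i : Fin 3) : Fin 3 → ℤ := fun j => if j = i then -2 else -1

theorem gap_injective : Function.Injective gap := fun i j h => by
  by_contra hij
  have := congrFun h i
  simp [gap, hij] at this

theorem exists_eq_gap {a : Fin 3 → ℤ} (h : a 0 + a 1 + a 2 = -4) (h0 : a 0 < 0) (h1 : a 1 < 0)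
    (h2 : a 2 < 0) : ∃ i, a = gap i := by
  have : a 0 = -2 ∧ a 1 = -1 ∧ a 2 = -1 ∨ a 0 = -1 ∧ a 1 = -2 ∧ a 2 = -1 ∨
      a 0 = -1 ∧ a 1 = -1 ∧ a 2 = -2 := by omega
  rcases this with ⟨h0, h1, h2⟩ | ⟨h0, h1, h2⟩ | ⟨h0, h1, h2⟩
  · exact ⟨0, funext fun j => by fin_cases j <;> simp [gap, h0, h1, h2]⟩
  · exact ⟨1, funext fun j => by fin_cases j <;> simp [gap, h0, h1, h2]⟩
  · exact ⟨2, funext fun j => by fin_cases j <;> simp [gap, h0, h1, h2]⟩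

theorem gap_mem (i : Fin 3) : gap i ∈ degreeSet {0, 1, 2} (-4) := by
  constructor
  · fin_cases i <;> rfl
  · intro j hj
    fin_cases j <;> simp at hj

theorem coeff_gap_eq_zero {T : Finset (Fin 3)} {N : ℤ} {q : Laurent₃ k}
    (hq : q ∈ supportedOn k (degreeSet T N)) {j : Fin 3} (hj : j ∉ T) (i : Fin 3) :
    q.coeff (gap i) = 0 :=
  coeff_eq_zero hq fun h => by
    have := h.2 j hj
    simp only [gap] at this
    split_ifs at this <;> omega

end Laurent₃

/-- Comparing in `W` makes `Z ⧸ B` and `V` quotients of `E` by the same kernel. -/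
theorem Submodule.finrank_quotient_eq_of_correspondence {k Z W E V : Type*} [Field k]
    [AddCommGroup Z] [AddCommGroup W] [AddCommGroup E] [AddCommGroup V] [Module k Z] [Module k W]
    [Module k E] [Module k V] (B : Submodule k Z) {ρ : Z →ₗ[k] W} (hρ : Function.Injective ρ)
    {p : E →ₗ[k] W} (hp : LinearMap.range p = LinearMap.range ρ) {β : E →ₗ[k] V}
    (hβ : Function.Surjective β) (h : ∀ e, β e = 0 ↔ p e ∈ B.map ρ) :
    Module.finrank k (Z ⧸ B) = Module.finrank k V := by
  have hmem (e : E) : p e ∈ LinearMap.range ρ := hp ▸ LinearMap.mem_range_self p e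
  let g : E →ₗ[k] Z := (LinearEquiv.ofInjective ρ hρ).symm.toLinearMap ∘ₗ p.codRestrict _ hmem
  have hg (e : E) : ρ (g e) = p e :=
    congrArg Subtype.val ((LinearEquiv.ofInjective ρ hρ).apply_symm_apply (p.codRestrict _ hmem e))
  have hgs : Function.Surjective (B.mkQ ∘ₗ g) := by
    refine (B.mkQ_surjective).comp fun z => ?_
    obtain ⟨e, he⟩ : ρ z ∈ LinearMap.range p := hp ▸ LinearMap.mem_range_self ρ z
    exact ⟨e, hρ ((hg e).trans he)⟩
  have hker : LinearMap.ker (B.mkQ ∘ₗ g) = LinearMap.ker β := by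
    ext e
    rw [LinearMap.mem_ker, LinearMap.mem_ker, h e, LinearMap.comp_apply, Submodule.mkQ_apply,
      Submodule.Quotient.mk_eq_zero, ← hg e]
    exact ⟨fun hz => ⟨_, hz, rfl⟩, fun ⟨z, hz, hze⟩ => hρ hze ▸ hz⟩
  exact (((LinearMap.ker β).quotEquivOfEq _ hker.symm).trans
    ((B.mkQ ∘ₗ g).quotKerEquivOfSurjective hgs)).symm.finrank_eq.trans
    (β.quotKerEquivOfSurjective hβ).finrank_eq

/-! ### The genus of a plane quartic: `H¹(C, 𝒪_C)` against `H²(ℙ², 𝒪(-4))` -/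

namespace PlaneCech

open AddMonoidAlgebra (single)
open Laurent₃

variable {k : Type*} [Field k]

/-- The Laurent polynomial cochains `(u₀₁, u₀₂, u₁₂, w)` of degree zero whose Čech differential is
`w` times the form `f` of degree four. -/
def liftedCocycles (f : MvPolynomial (Fin 3) k) :
    Submodule k ((Laurent₃ k × Laurent₃ k × Laurent₃ k) × Laurent₃ k) where
  carrier := {e | e.1.1 ∈ supportedOn k (degreeSet {0, 1} 0) ∧
    e.1.2.1 ∈ supportedOn k (degreeSet {0, 2} 0) ∧
    e.1.2.2 ∈ supportedOn k (degreeSet {1, 2} 0) ∧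
    e.2 ∈ supportedOn k (degreeSet {0, 1, 2} (-4)) ∧
    e.1.2.2 - e.1.2.1 + e.1.1 = ofPoly f * e.2}
  zero_mem' := ⟨zero_mem _, zero_mem _, zero_mem _, zero_mem _, by simp⟩
  add_mem' := by
    rintro x y ⟨h1, h2, h3, h4, h5⟩ ⟨g1, g2, g3, g4, g5⟩
    refine ⟨add_mem h1 g1, add_mem h2 g2, add_mem h3 g3, add_mem h4 g4, ?_⟩
    simp only [Prod.fst_add, Prod.snd_add]
    linear_combination h5 + g5
  smul_mem' := by
    rintro c x ⟨h1, h2, h3, h4, h5⟩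
    refine ⟨Submodule.smul_mem _ c h1, Submodule.smul_mem _ c h2, Submodule.smul_mem _ c h3,
      Submodule.smul_mem _ c h4, ?_⟩
    simp only [Prod.smul_fst, Prod.smul_snd, mul_smul_comm, ← h5, smul_add, smul_sub]

/-- The restriction of a Laurent polynomial cochain to the curve. -/
def liftedToLoc (f : MvPolynomial (Fin 3) k) :
    liftedCocycles f →ₗ[k] Loc f {0, 1, 2} × Loc f {0, 1, 2} × Loc f {0, 1, 2} :=
  (LinearMap.prodMap (ofLaurent f).toLinearMap
    (LinearMap.prodMap (ofLaurent f).toLinearMap (ofLaurent f).toLinearMap)) ∘ₗ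
    LinearMap.fst k _ _ ∘ₗ (liftedCocycles f).subtype

/-- The obstruction to splitting a Laurent polynomial cochain: the coefficients of `w` at the
exponents of degree `-4` with negative entries. -/
def gapCoeff (f : MvPolynomial (Fin 3) k) : liftedCocycles f →ₗ[k] (Fin 3 → k) where
  toFun e i := e.1.2.coeff (gap i)
  map_add' _ _ := rfl
  map_smul' _ _ := rfl

/-- The restriction of Čech `1`-cocycles to the open set where all coordinates are nonzero. -/
def Z1.restrict (f : MvPolynomial (Fin 3) k) :
    Z1 f →ₗ[k] Loc f {0, 1, 2} × Loc f {0, 1, 2} × Loc f {0, 1, 2} :=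
  (LinearMap.prodMap (PlaneCech.restrict f (T := {0, 1}) (by decide)).toLinearMap
    (LinearMap.prodMap (PlaneCech.restrict f (T := {0, 2}) (by decide)).toLinearMap
      (PlaneCech.restrict f (T := {1, 2}) (by decide)).toLinearMap)) ∘ₗ (Z1 f).subtype

theorem Z1.restrict_apply (f : MvPolynomial (Fin 3) k) (z : Z1 f) :
    Z1.restrict f z = (PlaneCech.restrict f (by decide) z.1.1,
      PlaneCech.restrict f (by decide) z.1.2.1, PlaneCech.restrict f (by decide) z.1.2.2) := rfl

theorem liftedToLoc_apply (f : MvPolynomial (Fin 3) k) (e : liftedCocycles f) :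
    liftedToLoc f e = (ofLaurent f e.1.1.1, ofLaurent f e.1.1.2.1, ofLaurent f e.1.1.2.2) := rfl

/-- In degree zero no monomial has three negative exponents, so `f w` is a Čech differential for
every `w` of degree `-4`. -/
theorem gapCoeff_surjective {f : MvPolynomial (Fin 3) k} (hd : f.IsHomogeneous 4) :
    Function.Surjective (gapCoeff f) := fun c => by
  classical
  let w : Laurent₃ k := ∑ i, single (gap i) (c i)
  have hw : w ∈ supportedOn k (degreeSet {0, 1, 2} (-4)) :=
    Submodule.sum_mem _ fun i _ => single_mem_supportedOn (gap_mem i) _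
  have hfw : ofPoly f * w ∈ supportedOn k (degreeSet {0, 1, 2} 0) := by
    refine mul_mem_supportedOn ?_ (ofPoly_mem hd) hw
    rintro a ⟨ha, ha'⟩ b ⟨hb, -⟩
    refine ⟨?_, fun i hi => ?_⟩
    · simp only [Pi.add_apply]
      push_cast at ha
      omega
    · fin_cases i <;> simp at hi
  obtain ⟨q₀₁, h₀₁, q₀₂, h₀₂, q₁₂, h₁₂, hq⟩ := exists_eq_alternating_sum hfw
    fun a h0 h1 h2 => coeff_eq_zero hfw fun h => by
      have := h.1
      omega
  refine ⟨⟨((q₀₁, q₀₂, q₁₂), w), h₀₁, h₀₂, h₁₂, hw, hq.symm⟩, funext fun i => ?_⟩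
  change w.coeff (gap i) = c i
  simp [w, AddMonoidAlgebra.coeff_sum, Finsupp.finsetSum_apply, AddMonoidAlgebra.coeff_single,
    Finsupp.single_apply, gap_injective.eq_iff]

section Prime

variable {f : MvPolynomial (Fin 3) k} (hf : Prime f) (hX : ∀ i, ¬ f ∣ X i)
  (hd : f.IsHomogeneous 4)

include hf hX in
theorem Z1.restrict_injective : Function.Injective (Z1.restrict f) := fun z z' h => by
  rw [Z1.restrict_apply, Z1.restrict_apply, Prod.mk.injEq, Prod.mk.injEq] at h
  exact Subtype.ext (Prod.ext (PlaneCech.restrict_injective hf hX _ h.1)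
    (Prod.ext (PlaneCech.restrict_injective hf hX _ h.2.1)
      (PlaneCech.restrict_injective hf hX _ h.2.2)))

include hf hX hd in
-- A cocycle on the curve lifts termwise to Laurent polynomials, and the differential of the lift
-- vanishes on the curve, hence is a multiple of `f`.
theorem range_liftedToLoc : LinearMap.range (liftedToLoc f) = LinearMap.range (Z1.restrict f) := by
  ext s
  constructor
  · rintro ⟨⟨⟨⟨u₀₁, u₀₂, u₁₂⟩, w⟩, h₀₁, h₀₂, h₁₂, -, hu⟩, rfl⟩
    obtain ⟨z₀₁, hz₀₁, e₀₁⟩ := exists_section_restrict_eq f (by decide) h₀₁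
    obtain ⟨z₀₂, hz₀₂, e₀₂⟩ := exists_section_restrict_eq f (by decide) h₀₂
    obtain ⟨z₁₂, hz₁₂, e₁₂⟩ := exists_section_restrict_eq f (by decide) h₁₂
    refine ⟨⟨(z₀₁, z₀₂, z₁₂), ⟨⟨hz₀₁, hz₀₂, hz₁₂⟩, ?_⟩⟩, ?_⟩
    · change PlaneCech.restrict f _ z₁₂ - PlaneCech.restrict f _ z₀₂ +
        PlaneCech.restrict f _ z₀₁ = 0
      rw [e₀₁, e₀₂, e₁₂, ← map_sub, ← map_add]
      exact hu ▸ ofLaurent_self_mul f w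
    · rw [Z1.restrict_apply, liftedToLoc_apply]
      exact Prod.ext e₀₁ (Prod.ext e₀₂ e₁₂)
  · rintro ⟨⟨⟨z₀₁, z₀₂, z₁₂⟩, ⟨⟨hz₀₁, hz₀₂, hz₁₂⟩, hz⟩⟩, rfl⟩
    obtain ⟨u₀₁, h₀₁, e₀₁⟩ := exists_ofLaurent_eq_restrict f (by decide) hz₀₁
    obtain ⟨u₀₂, h₀₂, e₀₂⟩ := exists_ofLaurent_eq_restrict f (by decide) hz₀₂
    obtain ⟨u₁₂, h₁₂, e₁₂⟩ := exists_ofLaurent_eq_restrict f (by decide) hz₁₂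
    have hmem : u₁₂ - u₀₂ + u₀₁ ∈ supportedOn k (degreeSet {0, 1, 2} 0) :=
      add_mem (sub_mem (degreeSet_mono (by decide) h₁₂) (degreeSet_mono (by decide) h₀₂))
        (degreeSet_mono (by decide) h₀₁)
    obtain ⟨w, hw, hu⟩ := exists_eq_mul_of_ofLaurent_eq_zero hf hX hd hmem (by
      rw [map_add, map_sub, e₀₁, e₀₂, e₁₂]
      exact hz)
    refine ⟨⟨((u₀₁, u₀₂, u₁₂), w), h₀₁, h₀₂, h₁₂, hw, hu⟩, ?_⟩
    rw [Z1.restrict_apply, liftedToLoc_apply]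
    exact Prod.ext e₀₁ (Prod.ext e₀₂ e₁₂)

include hf hX in
theorem restrict_mem_sections {T T' : Finset (Fin 3)} (h : T ⊆ T') (h' : T' ⊆ {0, 1, 2})
    {z : Loc f T} (hz : z ∈ sections f T) : PlaneCech.restrict f h z ∈ sections f T' := by
  obtain ⟨x, hx, hxz⟩ := exists_ofLaurent_eq_restrict f (h.trans h') hz
  obtain ⟨z', hz', hxz'⟩ := exists_section_restrict_eq f h' (degreeSet_mono h hx)
  rw [hxz, ← restrict_restrict f h h'] at hxz'
  exact PlaneCech.restrict_injective hf hX h' hxz' ▸ hz'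

include hf hX in
theorem B1_le_Z1 : B1 f ≤ Z1 f := by
  rintro _ ⟨⟨a₀, a₁, a₂⟩, ⟨ha₀, ha₁, ha₂⟩, rfl⟩
  refine ⟨⟨?_, ?_, ?_⟩, ?_⟩
  · exact sub_mem (restrict_mem_sections hf hX _ (by decide) ha₁)
      (restrict_mem_sections hf hX _ (by decide) ha₀)
  · exact sub_mem (restrict_mem_sections hf hX _ (by decide) ha₂)
      (restrict_mem_sections hf hX _ (by decide) ha₀)
  · exact sub_mem (restrict_mem_sections hf hX _ (by decide) ha₂)
      (restrict_mem_sections hf hX _ (by decide) ha₁)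
  · rw [SetLike.mem_coe, LinearMap.mem_ker]
    simp only [d₀, d₁, LinearMap.coe_mk, AddHom.coe_mk, map_sub, restrict_restrict]
    ring

include hf hX hd in
-- This is injectivity of the connecting map. If `w` is the differential of `q`, then `u - f q` is a
-- cocycle on `ℙ²`, hence a coboundary, and agrees with `u` on the curve. Conversely, if `u` is a
-- coboundary on the curve, it differs from one on `ℙ²` by some `f q`; cancelling `f` shows `w` to
-- be the differential of `q`, which has no gap coefficients.
theorem gapCoeff_eq_zero_iff (e : liftedCocycles f) :
    gapCoeff f e = 0 ↔ liftedToLoc f e ∈ ((B1 f).submoduleOf (Z1 f)).map (Z1.restrict f) := by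
  obtain ⟨⟨⟨u₀₁, u₀₂, u₁₂⟩, w⟩, h₀₁, h₀₂, h₁₂, hw, hu⟩ := e
  rw [liftedToLoc_apply]
  dsimp only at h₀₁ h₀₂ h₁₂ hw hu ⊢
  have hmul {T : Finset (Fin 3)} {q : Laurent₃ k} (hq : q ∈ supportedOn k (degreeSet T (-4))) :
      ofPoly f * q ∈ supportedOn k (degreeSet T 0) := by
    refine mul_mem_supportedOn ?_ (ofPoly_mem hd) hq
    rintro a ⟨ha, ha'⟩ b ⟨hb, hb'⟩
    refine ⟨?_, fun i hi => add_nonneg (ha' i (by simp)) (hb' i hi)⟩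
    simp only [Pi.add_apply]
    push_cast at ha
    omega
  constructor
  · intro h
    obtain ⟨q₀₁, hq₀₁, q₀₂, hq₀₂, q₁₂, hq₁₂, hq⟩ := exists_eq_alternating_sum hw
      fun a h0 h1 h2 => by
        by_contra hne
        obtain ⟨i, rfl⟩ := exists_eq_gap (hw a hne).1 h0 h1 h2
        exact hne (congrFun h i)
    obtain ⟨v₀, hv₀, v₁, hv₁, v₂, hv₂, e₀₁, e₀₂, e₁₂⟩ := exists_coboundary
      (sub_mem h₀₁ (hmul hq₀₁)) (sub_mem h₀₂ (hmul hq₀₂)) (sub_mem h₁₂ (hmul hq₁₂))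
      (by rw [hq] at hu; linear_combination hu)
    obtain ⟨a₀, ha₀, r₀⟩ := exists_section_restrict_eq f (by decide) hv₀
    obtain ⟨a₁, ha₁, r₁⟩ := exists_section_restrict_eq f (by decide) hv₁
    obtain ⟨a₂, ha₂, r₂⟩ := exists_section_restrict_eq f (by decide) hv₂
    have hB : d₀ f (a₀, a₁, a₂) ∈ B1 f := ⟨(a₀, a₁, a₂), ⟨ha₀, ha₁, ha₂⟩, rfl⟩
    refine ⟨⟨_, B1_le_Z1 hf hX hB⟩, hB, ?_⟩
    have hsplit {u q v v' : Laurent₃ k} (h : u - ofPoly f * q = v - v') :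
        ofLaurent f u = ofLaurent f v - ofLaurent f v' := by
      rw [← map_sub, ← h, map_sub, ofLaurent_self_mul, sub_zero]
    rw [Z1.restrict_apply, hsplit e₀₁, hsplit e₀₂, hsplit e₁₂, ← r₀, ← r₁, ← r₂]
    simp only [d₀, LinearMap.coe_mk, AddHom.coe_mk, map_sub, restrict_restrict]
  · rintro ⟨z, hzB, hzu⟩
    obtain ⟨⟨a₀, a₁, a₂⟩, ⟨ha₀, ha₁, ha₂⟩, hz⟩ : z.1 ∈ B1 f := hzB
    obtain ⟨v₀, hv₀, r₀⟩ := exists_ofLaurent_eq_restrict f (by decide) ha₀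
    obtain ⟨v₁, hv₁, r₁⟩ := exists_ofLaurent_eq_restrict f (by decide) ha₁
    obtain ⟨v₂, hv₂, r₂⟩ := exists_ofLaurent_eq_restrict f (by decide) ha₂
    rw [Z1.restrict_apply] at hzu
    rw [← hz] at hzu
    simp only [d₀, LinearMap.coe_mk, AddHom.coe_mk, map_sub, restrict_restrict, ← r₀, ← r₁, ← r₂,
      Prod.mk.injEq] at hzu
    obtain ⟨e₀₁, e₀₂, e₁₂⟩ := hzu
    obtain ⟨q₀₁, hq₀₁, s₀₁⟩ := exists_eq_mul_of_ofLaurent_eq_zero hf hX hd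
      (sub_mem h₀₁ (sub_mem (degreeSet_mono (by decide) hv₁) (degreeSet_mono (by decide) hv₀)))
      (by rw [map_sub, map_sub, e₀₁, sub_self])
    obtain ⟨q₀₂, hq₀₂, s₀₂⟩ := exists_eq_mul_of_ofLaurent_eq_zero hf hX hd
      (sub_mem h₀₂ (sub_mem (degreeSet_mono (by decide) hv₂) (degreeSet_mono (by decide) hv₀)))
      (by rw [map_sub, map_sub, e₀₂, sub_self])
    obtain ⟨q₁₂, hq₁₂, s₁₂⟩ := exists_eq_mul_of_ofLaurent_eq_zero hf hX hd
      (sub_mem h₁₂ (sub_mem (degreeSet_mono (by decide) hv₂) (degreeSet_mono (by decide) hv₁)))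
      (by rw [map_sub, map_sub, e₁₂, sub_self])
    have hw' : w = q₁₂ - q₀₂ + q₀₁ := by
      have hf0 : ofPoly f ≠ 0 := by
        rw [← map_zero ofPoly]
        exact ofPoly_injective.ne hf.ne_zero
      refine mul_left_cancel₀ hf0 ?_
      linear_combination s₁₂ - s₀₂ + s₀₁ - hu
    refine funext fun i => ?_
    change w.coeff (gap i) = 0
    rw [hw', AddMonoidAlgebra.coeff_add, AddMonoidAlgebra.coeff_sub, Finsupp.add_apply,
      Finsupp.sub_apply, coeff_gap_eq_zero hq₀₁ (j := 2) (by decide),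
      coeff_gap_eq_zero hq₀₂ (j := 1) (by decide), coeff_gap_eq_zero hq₁₂ (j := 0) (by decide)]
    simp

include hf hX hd in
theorem finrank_H1 : Module.finrank k (H1 f) = 3 := by
  rw [Submodule.finrank_quotient_eq_of_correspondence _ (Z1.restrict_injective hf hX)
    (range_liftedToLoc hf hX hd) (gapCoeff_surjective hd) (gapCoeff_eq_zero_iff hf hX hd)]
  simp

end Prime

end PlaneCech

theorem SmoothPlaneCurve.genus_eq_three {k : Type*} [Field k] (C : SmoothPlaneCurve k 4) :
    C.genus = 3 := by
  -- Units are recognized over the algebraic closure, so irreducibility descends; the quartic then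
  -- divides no coordinate for reasons of degree.
  have : IsLocalHom (map (σ := Fin 3) (algebraMap k (AlgebraicClosure k))) := ⟨fun a ha => by
    rw [isUnit_iff_totalDegree_of_isReduced] at ha ⊢
    rwa [coeff_map, isUnit_map_iff, totalDegree,
      support_map_of_injective _ (algebraMap k (AlgebraicClosure k)).injective] at ha⟩
  have hirr : Irreducible C.form := C.geomIrreducible.of_map
  refine PlaneCech.finrank_H1 hirr.prime (fun i hi => ?_) C.isHomogeneous
  have h1 := totalDegree_le_of_dvd_of_isDomain hi (X_ne_zero i)
  rw [C.isHomogeneous.totalDegree hirr.ne_zero, totalDegree_X] at h1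
  omega

end

theorem mainTheorem11 :
    -- plane curves of every degree `d ≥ 3` without abelian points
    (∀ d : ℕ, 3 ≤ d → ∃ C : SmoothPlaneCurve LaurentQ d, C.NoAbelianPoints) ∧
    -- they arise as general plane sections of `N = t Z ^ d`, for every `S_d`-field of degree `d`;
    -- "general": for all planes in a nonempty Zariski open set `P ≠ 0`
    (∀ d : ℕ, 3 ≤ d →
      (∃ (K : Type) (_ : Field K) (_ : NumberField K), IsSymmetricNumberField d K) ∧
      ∀ (K : Type*) [Field K] [NumberField K], IsSymmetricNumberField d K →
        ∀ b : Module.Basis (Fin d) ℚ K,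
          ∃ P : MvPolynomial (Option (Fin d) × Fin 3) LaurentQ, P ≠ 0 ∧
            ∀ A : Matrix (Option (Fin d)) (Fin 3) LaurentQ,
              MvPolynomial.eval (fun p => A p.1 p.2) P ≠ 0 →
                Function.Injective A.mulVec ∧
                ∃ C : SmoothPlaneCurve LaurentQ d,
                  C.form = planeSection (normHypersurface b) A ∧ C.NoAbelianPoints) ∧
    -- in particular, a plane quartic curve of genus `3` without abelian points
    (∃ C : SmoothPlaneCurve LaurentQ 4, C.genus = 3 ∧ C.NoAbelianPoints) := by
  refine ⟨fun d hd => ?_, fun d hd => ⟨exists_isSymmetricNumberField (by omega), fun K _ _ hK b =>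
    exists_general_smoothPlaneCurve hd hK b⟩, ?_⟩
  · obtain ⟨K, _, _, hK⟩ := exists_isSymmetricNumberField (d := d) (by omega)
    exact hK.exists_smoothPlaneCurve hd
  · obtain ⟨K, _, _, hK⟩ := exists_isSymmetricNumberField (d := 4) (by omega)
    obtain ⟨C, hC⟩ := hK.exists_smoothPlaneCurve (by omega)
    exact ⟨C, C.genus_eq_three, hC⟩
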